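/- **Setting.** For $N\ge 4$ let $\Lambda_N=\{x_k\}_{k\ge 0}$ with $x_0=0$ and $x_k=1+\frac1{N-1-x_{k-1}}$; let $\Lambda_3=\{3/2\}$. Let $P=(P_0,\dots,P_{N-1})$ be orthogonal projections on $\mathbb C^d$ with $\sum_\mu P_\mu=x\,\mathbb I_d$ for a rational $x$. The Slater state is the unit vector $$|\Psi_{\mathrm S}\rangle=\frac1{\sqrt{d!}}\sum_{\sigma}\mathrm{sign}(\sigma)\,|\sigma(0)\rangle\otimes\dots\otimes|\sigma(d-1)\rangle\in(\mathbb C^d)^{\otimes d},$$ where $\sigma$ ranges over the permutations of $\{0,\dots,d-1\}$. In the canonical strategy of $P$, $d$ parties share $|\Psi_{\mathrm S}\rangle$ and each party has the $N$ binary measurements $\tilde E_{\mu,0}=P_\mu$, $\tilde E_{\mu,1}=\mathbb I_d-P_\mu$. Put $\tilde E_{\boldsymbol\mu,\boldsymbol a}=\tilde E_{\mu_0,a_0}\otimes\dots\otimes\tilde E_{\mu_{d-1},a_{d-1}}$ and $\tilde p(\boldsymbol a|\boldsymbol\mu)=\langle\Psi_{\mathrm S}|\tilde E_{\boldsymbol\mu,\boldsymbol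 a}|\Psi_{\mathrm S}\rangle$, for $\boldsymbol a\in\{0,1\}^d$, $\boldsymbol\mu\in\{0,\dots,N-1\}^d$. The correlation $\tilde p$ *self-tests* the canonical strategy (the Slater state with its measurements) if the following holds for all finite-dimensional Hilbert spaces $\mathcal H_0,\dots,\mathcal H_{d-1}$, every unit vector $|\Psi\rangle\in\bigotimes_k\mathcal H_k$ and all two-outcome POVMs $\{E^{(k)}_{\mu,0},E^{(k)}_{\mu,1}\}$ on $\mathcal H_k$ (with $E_{\boldsymbol\mu,\boldsymbol a}=\bigotimes_kE^{(k)}_{\mu_k,a_k}$): if $\langle\Psi|E_{\boldsymbol\mu,\boldsymbol a}|\Psi\rangle=\tilde p(\boldsymbol a|\boldsymbol\mu)$ for all $\boldsymbol a,\boldsymbol\mu$, then there are finite-dimensional Hilbert spaces $\mathcal I_k$, isometries $V_k:\mathcal H_k\to\mathbb C^d\otimes\mathcal I_k$ and a unit vector $|\psi_{\mathrm{junk}}\rangle\in\bigotimes_k\mathcal I_k$ such that $$\Big(\bigotimes_kV_k\Big)|\Psi\rangle=|\Psi_{\mathrm S}\rangle\otimes|\psi_{\mathrm{junk}}\rangle,\qquad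 \Big(\bigotimes_kV_k\Big)E_{\boldsymbol\mu,\boldsymbol a}|\Psi\rangle=\tilde E_{\boldsymbol\mu,\boldsymbol a}|\Psi_{\mathrm S}\rangle\otimes|\psi_{\mathrm{junk}}\rangle\quad\text{for all }\boldsymbol a,\boldsymbol\mu .$$ For operators $A_0,\dots,A_{d-1}$ on $\mathbb C^d$ let $\mathcal S(A_0\otimes\dots\otimes A_{d-1})=\frac1{d!}\sum_\sigma A_{\sigma(0)}\otimes\dots\otimes A_{\sigma(d-1)}$, and let $$S_\mu=\binom{d}{r}\,\mathcal S\big(P_\mu^{\otimes r}\otimes(\mathbb I_d-P_\mu)^{\otimes(d-r)}\big),\qquad r=\operatorname{rank}P_\mu .$$ *Conjecture 1 for $P$*: every vector lying in the ranges of all the $S_\mu$, $\mu=0,\dots,N-1$, is a scalar multiple of $|\Psi_{\mathrm S}\rangle$. **Theorem.** 1. Let $x\in\Lambda_N$ ($N=3$ or $N\ge4$), let $d$ be the denominator of $x$ in lowest terms, and let $P_0,\dots,P_{N-1}$ be orthogonal projections on $\mathbb C^d$ with $\sum_\mu P_\mu=x\,\mathbb I_d$. If Conjecture 1 holds for $P$,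 then $\tilde p$ self-tests the canonical strategy of $P$, and in particular the Slater state. 2. For every $d\ge1$ there are $d+1$ orthogonal projections on $\mathbb C^d$ with $\sum_\mu P_\mu=\frac{d+1}d\mathbb I_d$, and for every such family $\tilde p$ self-tests the canonical strategy of $P$. Thus the Slater state is self-tested with $d+1$ binary measurements per party. 3. For every odd $d\ge 1$ there are four orthogonal projections on $\mathbb C^d$ with $\sum_\mu P_\mu=\frac{2(d-1)}d\mathbb I_d$, and for every such family $\tilde p$ self-tests the canonical strategy of $P$. Thus the Slater state is self-tested with four binary measurements per party. -/

import Mathlib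

open scoped Matrix ComplexOrder

noncomputable section

namespace SlaterSelfTest

/-- The tensor (Kronecker) product `A 0 ⊗ A 1 ⊗ ... ⊗ A (n-1)` of a finite family of matrices.
The tensor product of the spaces `ℂ^(ι k)` is the space of functions on `∀ k, ι k`, the basis vector
`|i 0⟩ ⊗ ... ⊗ |i (n-1)⟩` corresponding to the multi-index `i`. -/
def tensorMat {n : ℕ} {ι κ : Fin n → Type} (A : ∀ k, Matrix (ι k) (κ k) ℂ) :
    Matrix (∀ k, ι k) (∀ k, κ k) ℂ :=
  Matrix.of fun i j => ∏ k, A k (i k) (j k)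

/-- For `ψ ∈ ⊗ₖ ℂ^(ι k)` and `χ ∈ ⊗ₖ ℂ^(κ k)`, the vector `ψ ⊗ χ`, with its tensor factors
regrouped as an element of `⊗ₖ (ℂ^(ι k) ⊗ ℂ^(κ k))`. -/
def tensorVec {n : ℕ} {ι κ : Fin n → Type} (ψ : (∀ k, ι k) → ℂ) (χ : (∀ k, κ k) → ℂ) :
    (∀ k, ι k × κ k) → ℂ :=
  fun i => ψ (fun k => (i k).1) * χ (fun k => (i k).2)

/-- A quantum realization of a Bell experiment with `n` parties, each having `N` binary measurements:
the local Hilbert space of party `k` is `ℂ^(m k)`, the shared pure state is a unit vector of the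
tensor product, and `povm k μ a` is the effect of outcome `a` in the measurement `μ` of party `k`. -/
structure Realization (N : ℕ) {n : ℕ} (m : Fin n → ℕ) where
  state : (∀ k, Fin (m k)) → ℂ
  state_unit : star state ⬝ᵥ state = 1
  povm : ∀ k, Fin N → Fin 2 → Matrix (Fin (m k)) (Fin (m k)) ℂ
  povm_pos : ∀ k μ a, (povm k μ a).PosSemidef
  povm_sum : ∀ k μ, povm k μ 0 + povm k μ 1 = 1

namespace Realization

variable {N n : ℕ} {m : Fin n → ℕ}

/-- The joint effect `⊗ₖ E^(k)_{μ k, a k}`. -/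
def effect (R : Realization N m) (a : Fin n → Fin 2) (μ : Fin n → Fin N) :
    Matrix (∀ k, Fin (m k)) (∀ k, Fin (m k)) ℂ :=
  tensorMat fun k => R.povm k (μ k) (a k)

/-- The correlation `p(a|μ) = ⟨Ψ| ⊗ₖ E^(k)_{μ k, a k} |Ψ⟩`. -/
def correlation (R : Realization N m) (a : Fin n → Fin 2) (μ : Fin n → Fin N) : ℂ :=
  star R.state ⬝ᵥ (R.effect a μ *ᵥ R.state)

/-- The correlation of the reference realization `R₀` self-tests `R₀`: for every realization `R`, on
arbitrary finite-dimensional local spaces, that produces the same correlation, there are local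
isometries `V k : ℂ^(m k) → ℂ^(m₀ k) ⊗ ℂ^(q k)` and a junk state `χ` such that `⊗ₖ V k` maps the state
of `R` to `Ψ₀ ⊗ χ` and maps each measured state of `R` to the measured reference state tensor `χ`. -/
def SelfTests {m₀ : Fin n → ℕ} (R₀ : Realization N m₀) : Prop :=
  ∀ (m : Fin n → ℕ) (R : Realization N m),
    (∀ a μ, R.correlation a μ = R₀.correlation a μ) →
    ∃ (q : Fin n → ℕ) (V : ∀ k, Matrix (Fin (m₀ k) × Fin (q k)) (Fin (m k)) ℂ)
      (χ : (∀ k, Fin (q k)) → ℂ),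
      (∀ k, (V k)ᴴ * V k = 1) ∧ star χ ⬝ᵥ χ = 1 ∧
      tensorMat V *ᵥ R.state = tensorVec R₀.state χ ∧
      ∀ a μ, tensorMat V *ᵥ (R.effect a μ *ᵥ R.state)
        = tensorVec (R₀.effect a μ *ᵥ R₀.state) χ

end Realization

/-- The Slater state `(1/√d!) ∑_σ sign(σ) |σ(0) σ(1) ... σ(d-1)⟩` in `(ℂ^d)^{⊗ d}`. -/
def slater (d : ℕ) : (Fin d → Fin d) → ℂ :=
  fun i => ((1 / Real.sqrt (d.factorial : ℝ) : ℝ) : ℂ) *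
    ∑ σ : Equiv.Perm (Fin d), ((Equiv.Perm.sign σ : ℤ) : ℂ) * (if i = ⇑σ then 1 else 0)

lemma slater_perm (d : ℕ) (σ : Equiv.Perm (Fin d)) :
    slater d σ = ((1 / Real.sqrt (d.factorial : ℝ) : ℝ) : ℂ) * ((Equiv.Perm.sign σ : ℤ) : ℂ) := by
  unfold slater
  congr 1
  rw [Finset.sum_eq_single σ]
  · simp
  · intro τ _ hτ
    rw [if_neg (fun h => hτ (DFunLike.coe_injective h).symm), mul_zero]
  · simp

lemma slater_unit (d : ℕ) : star (slater d) ⬝ᵥ slater d = 1 := by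
  have h0 : ∀ i : Fin d → Fin d, i ∉ Set.range (fun σ : Equiv.Perm (Fin d) => (⇑σ)) →
      star (slater d) i * slater d i = 0 := by
    intro i hi
    have : slater d i = 0 := by
      unfold slater
      rw [Finset.sum_eq_zero, mul_zero]
      intro σ _
      rw [if_neg (fun h => hi ⟨σ, h.symm⟩), mul_zero]
    rw [this, mul_zero]
  have hinj : Function.Injective (fun σ : Equiv.Perm (Fin d) => (⇑σ)) := DFunLike.coe_injective
  have h1 : ∀ σ : Equiv.Perm (Fin d), star (slater d) σ * slater d σ = ((d.factorial : ℂ))⁻¹ := by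
    intro σ
    rw [Pi.star_apply, slater_perm]
    have hs : ((Equiv.Perm.sign σ : ℤ) : ℂ) * ((Equiv.Perm.sign σ : ℤ) : ℂ) = 1 := by
      rcases Int.units_eq_one_or (Equiv.Perm.sign σ) with h | h <;> simp [h]
    have hr : ((1 / Real.sqrt (d.factorial : ℝ) : ℝ) : ℂ) * ((1 / Real.sqrt (d.factorial : ℝ) : ℝ) : ℂ)
        = ((d.factorial : ℂ))⁻¹ := by
      rw [← Complex.ofReal_mul, div_mul_div_comm, Real.mul_self_sqrt (by positivity)]
      push_cast
      simp
    have hstar : star (((1 / Real.sqrt (d.factorial : ℝ) : ℝ) : ℂ) * ((Equiv.Perm.sign σ : ℤ) : ℂ))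
        = ((1 / Real.sqrt (d.factorial : ℝ) : ℝ) : ℂ) * ((Equiv.Perm.sign σ : ℤ) : ℂ) := by
      rw [Complex.star_def, map_mul, Complex.conj_ofReal, map_intCast]
    rw [hstar, mul_mul_mul_comm, hs, hr, mul_one]
  unfold dotProduct
  rw [← Fintype.sum_of_injective _ hinj (fun _ => ((d.factorial : ℂ))⁻¹) _ h0 (fun σ => (h1 σ).symm)]
  rw [Finset.sum_const, Finset.card_univ, Fintype.card_perm, Fintype.card_fin, nsmul_eq_mul]
  exact mul_inv_cancel₀ (by exact_mod_cast d.factorial_ne_zero)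

/-- `P 0, ..., P (N-1)` are orthogonal projections of `ℂ^d` with sum `x • 1`. -/
structure IsProjFamily {N d : ℕ} (x : ℚ) (P : Fin N → Matrix (Fin d) (Fin d) ℂ) : Prop where
  isProj : ∀ μ, IsStarProjection (P μ)
  sum_eq : ∑ μ, P μ = (x : ℂ) • (1 : Matrix (Fin d) (Fin d) ℂ)

lemma posSemidef_of_isStarProjection {d : ℕ} {A : Matrix (Fin d) (Fin d) ℂ}
    (hA : IsStarProjection A) : A.PosSemidef := by
  have h : Aᴴ * A = A := by
    have h1 : Aᴴ = A := hA.isSelfAdjoint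
    rw [h1]
    exact hA.isIdempotentElem
  rw [← h]
  exact Matrix.posSemidef_conjTranspose_mul_self A

/-- The canonical strategy: `d` parties with local space `ℂ^d` share the Slater state and each party
has the `N` binary measurements `{P μ, 1 - P μ}`, outcome `0` being `P μ`. -/
def canonical {N d : ℕ} {x : ℚ} {P : Fin N → Matrix (Fin d) (Fin d) ℂ} (hP : IsProjFamily x P) :
    Realization N (fun _ : Fin d => d) where
  state := slater d
  state_unit := slater_unit d
  povm := fun _ μ a => if a = 0 then P μ else 1 - P μ
  povm_pos := by
    intro _ μ a
    split_ifs
    · exact posSemidef_of_isStarProjection (hP.isProj μ)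
    · exact posSemidef_of_isStarProjection (hP.isProj μ).one_sub
  povm_sum := by
    intro _ μ
    simp

/-- The symmetrizer `𝒮(A 0 ⊗ ... ⊗ A (d-1)) = (1/d!) ∑_σ A (σ 0) ⊗ ... ⊗ A (σ (d-1))`. -/
def symmetrizer {d : ℕ} (A : Fin d → Matrix (Fin d) (Fin d) ℂ) :
    Matrix (Fin d → Fin d) (Fin d → Fin d) ℂ :=
  (1 / (d.factorial : ℂ)) • ∑ σ : Equiv.Perm (Fin d), tensorMat fun k => A (σ k)

/-- For a projection `Q` of rank `r`, the operator
`(d choose r) 𝒮(Q ⊗ ... ⊗ Q ⊗ (1 - Q) ⊗ ... ⊗ (1 - Q))` with `r` factors `Q` and `d - r` factors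
`1 - Q`; for `Q = P μ` this is `S_μ`. -/
def symProj {d : ℕ} (Q : Matrix (Fin d) (Fin d) ℂ) : Matrix (Fin d → Fin d) (Fin d → Fin d) ℂ :=
  (d.choose Q.rank : ℂ) • symmetrizer fun k => if (k : ℕ) < Q.rank then Q else 1 - Q

/-- The Slater state is, up to a scalar, the only vector in the ranges of all `S_μ`. -/
def SlaterUnique {N d : ℕ} (P : Fin N → Matrix (Fin d) (Fin d) ℂ) : Prop :=
  ∀ φ : (Fin d → Fin d) → ℂ, (∀ μ, φ ∈ Set.range (symProj (P μ)).mulVec) →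
    ∃ c : ℂ, φ = c • slater d

/-- The sequence `x₀ = 0`, `x_{k+1} = 1 + 1 / (N - 1 - x_k)`. -/
def lambdaSeq (N : ℕ) : ℕ → ℚ
  | 0 => 0
  | k + 1 => 1 + 1 / ((N : ℚ) - 1 - lambdaSeq N k)

/-- `Λ_3 = {3/2}`, and `Λ_N = {x_k : k ≥ 0}` for `N ≥ 4`. -/
def Lambda (N : ℕ) : Set ℚ :=
  {x | (N = 3 ∧ x = 3 / 2) ∨ (4 ≤ N ∧ ∃ k, x = lambdaSeq N k)}

end SlaterSelfTest

end

/-! The Slater state is the determinant representation: every `X` in `gl_d`, acting by derivations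
(`derivAct`), multiplies it by `trace X`. Hence measuring `P μ` at all parties always gives exactly
`rank (P μ)` zeros. Any realization with the same correlation has this property, so the outcome of
one party is determined by those of the others. On the state, a local effect may then be traded for
an operator of the other parties (`FixedZeros.site_povm_mulVec'`). This makes each effect a
projection on the local support and the support invariant. The norm of the defect in `∑ μ, E μ = x`
is a function of the correlation alone (`FixedZeros.star_sumDefect`), so the relation holds there
too.

What remains is the classification of projection families of weight `x`. The parameters `(d; r, …,
r)` satisfy `d² + N r² - N r d = 1`, the equation of a real root of a star-shaped quiver. This
equation makes `d` coprime to `N r`, so every such family has dimension divisible by `d`, which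
gives Schur's lemma. An Euler-form bound on intertwiners (`two_mul_le_finrank_intertwiners`)
produces a nonzero one into any other family, hence an isometric one, and by induction every family
of weight `x` is a multiple of `P` (`RigidParams.exists_decomposition`). This supplies the local
isometries. After applying them, each junk slice of the state lies in the ranges of all `S_μ`, so
`SlaterUnique` makes it a multiple of the Slater state, and the coefficients are the junk state
(`RigidParams.selfTests`).

The elements of `Λ_N` come from the roots `(1; 0, …, 0)` for `N ≥ 4`, by a reflection preserving the
form, and `(2; 1, 1, 1)` for `N = 3`. For the two unconditional families, uniqueness follows once
the projections and the identity generate `gl_d` as a Lie algebra (`slaterUnique_of_lieGenerates`).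
By rigidity it is enough to check this on one model: the regular simplex for `d + 1` projections,
and two pairs of reflections for four. -/

open scoped Matrix ComplexOrder Kronecker

noncomputable section

namespace SlaterSelfTest

/-! ### Tensor products of matrices and operators on a single factor. -/

section Tensor

set_option linter.unusedSectionVars false

variable {n : ℕ} {ι κ τ : Fin n → Type}

lemma tensorMat_apply (A : ∀ k, Matrix (ι k) (κ k) ℂ) (i : ∀ k, ι k) (j : ∀ k, κ k) :
    tensorMat A i j = ∏ k, A k (i k) (j k) := rfl

lemma tensorMat_mul [∀ k, Fintype (κ k)] (A : ∀ k, Matrix (ι k) (κ k) ℂ)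
    (B : ∀ k, Matrix (κ k) (τ k) ℂ) :
    tensorMat A * tensorMat B = tensorMat fun k => A k * B k := by
  classical
  ext i j
  simp only [Matrix.mul_apply, tensorMat_apply]
  rw [Finset.prod_univ_sum, Fintype.piFinset_univ]
  exact Finset.sum_congr rfl fun _ _ => Finset.prod_mul_distrib.symm

lemma tensorMat_mul_mulVec [∀ k, Fintype (κ k)] [∀ k, Fintype (τ k)]
    (A : ∀ k, Matrix (ι k) (κ k) ℂ)
    (B : ∀ k, Matrix (κ k) (τ k) ℂ) (v : (∀ k, τ k) → ℂ) :
    tensorMat A *ᵥ (tensorMat B *ᵥ v) = tensorMat (fun k => A k * B k) *ᵥ v := by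
  rw [Matrix.mulVec_mulVec, tensorMat_mul]

lemma tensorMat_conjTranspose (A : ∀ k, Matrix (ι k) (κ k) ℂ) :
    (tensorMat A)ᴴ = tensorMat fun k => (A k)ᴴ := by
  ext i j
  simp [tensorMat_apply, Matrix.conjTranspose_apply]

variable [∀ k, DecidableEq (ι k)]

lemma tensorMat_one : tensorMat (fun k => (1 : Matrix (ι k) (ι k) ℂ)) = 1 := by
  ext i j
  rw [tensorMat_apply, Matrix.one_apply]
  split_ifs with h
  · subst h
    exact Finset.prod_eq_one fun k _ => Matrix.one_apply_eq (i k)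
  · obtain ⟨k, hk⟩ := Function.ne_iff.mp h
    exact Finset.prod_eq_zero (Finset.mem_univ k) (Matrix.one_apply_ne hk)

lemma tensorMat_update_apply (A : ∀ k, Matrix (ι k) (κ k) ℂ) (k : Fin n)
    (X : Matrix (ι k) (κ k) ℂ) (i : ∀ k, ι k) (j : ∀ k, κ k) :
    tensorMat (Function.update A k X) i j =
      X (i k) (j k) * ∏ l ∈ Finset.univ.erase k, A l (i l) (j l) := by
  rw [tensorMat_apply, ← Finset.mul_prod_erase _ _ (Finset.mem_univ k), Function.update_self]
  congr 1
  refine Finset.prod_congr rfl fun l hl => ?_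
  rw [Function.update_of_ne (Finset.ne_of_mem_erase hl)]

lemma tensorMat_update_add (A : ∀ k, Matrix (ι k) (κ k) ℂ) (k : Fin n)
    (X Y : Matrix (ι k) (κ k) ℂ) :
    tensorMat (Function.update A k (X + Y)) =
      tensorMat (Function.update A k X) + tensorMat (Function.update A k Y) := by
  ext i j
  simp only [Matrix.add_apply, tensorMat_update_apply, add_mul]

lemma tensorMat_update_smul (A : ∀ k, Matrix (ι k) (κ k) ℂ) (k : Fin n) (c : ℂ)
    (X : Matrix (ι k) (κ k) ℂ) :
    tensorMat (Function.update A k (c • X)) = c • tensorMat (Function.update A k X) := by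
  ext i j
  simp only [Matrix.smul_apply, tensorMat_update_apply, smul_eq_mul, mul_assoc]

/-- The sum over all choice functions of a tensor product is the tensor product of the sums. -/
lemma sum_tensorMat {α : Type} [Fintype α] [DecidableEq α] (A : ∀ k, α → Matrix (ι k) (κ k) ℂ) :
    ∑ a : Fin n → α, tensorMat (fun k => A k (a k)) = tensorMat fun k => ∑ b, A k b := by
  ext i j
  simp only [Matrix.sum_apply, tensorMat_apply]
  rw [Finset.prod_univ_sum, Fintype.piFinset_univ]

lemma tensorMat_posSemidef [∀ k, Fintype (ι k)] {A : ∀ k, Matrix (ι k) (ι k) ℂ}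
    (hA : ∀ k, (A k).PosSemidef) : (tensorMat A).PosSemidef := by
  have hex : ∀ k, ∃ B : Matrix (ι k) (ι k) ℂ, A k = Bᴴ * B := fun k => by
    open scoped MatrixOrder in
    obtain ⟨X, hX, -, h⟩ := CFC.exists_sqrt_of_isSelfAdjoint_of_quasispectrumRestricts
      (hA k).isHermitian (QuasispectrumRestricts.nnreal_of_nonneg (hA k).nonneg)
    exact ⟨X, h.symm.trans (congrArg (· * X) hX.star_eq.symm)⟩
  choose B hB using hex
  have : tensorMat A = (tensorMat B)ᴴ * tensorMat B := by
    rw [tensorMat_conjTranspose, tensorMat_mul]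
    exact congrArg tensorMat (funext hB)
  rw [this]
  exact Matrix.posSemidef_conjTranspose_mul_self _

/-- The operator `X` acting on the tensor factor `k`. -/
def site (k : Fin n) (X : Matrix (ι k) (ι k) ℂ) : Matrix (∀ k, ι k) (∀ k, ι k) ℂ :=
  tensorMat (Function.update (fun _ => 1) k X)

variable [∀ k, Fintype (ι k)]

lemma site_mul_tensorMat (k : Fin n) (X : Matrix (ι k) (ι k) ℂ) (A : ∀ k, Matrix (ι k) (κ k) ℂ) :
    site k X * tensorMat A = tensorMat (Function.update A k (X * A k)) := by
  rw [site, tensorMat_mul]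
  congr 1
  ext1 l
  rcases eq_or_ne l k with rfl | h
  · simp
  · simp [Function.update_of_ne h]

lemma tensorMat_mul_site (k : Fin n) (X : Matrix (ι k) (ι k) ℂ) (A : ∀ k, Matrix (ι k) (ι k) ℂ) :
    tensorMat A * site k X = tensorMat (Function.update A k (A k * X)) := by
  rw [site, tensorMat_mul]
  congr 1
  ext1 l
  rcases eq_or_ne l k with rfl | h
  · simp
  · simp [Function.update_of_ne h]

lemma site_mul (k : Fin n) (X Y : Matrix (ι k) (ι k) ℂ) : site k X * site k Y = site k (X * Y) := by
  rw [site, site, ← site, site_mul_tensorMat]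
  simp [site]

lemma site_comm {k l : Fin n} (h : k ≠ l) (X : Matrix (ι k) (ι k) ℂ) (Y : Matrix (ι l) (ι l) ℂ) :
    site k X * site l Y = site l Y * site k X := by
  rw [site.eq_def l, site_mul_tensorMat, tensorMat_mul_site]
  rw [Function.update_of_ne h, mul_one, one_mul]

lemma site_add (k : Fin n) (X Y : Matrix (ι k) (ι k) ℂ) : site k (X + Y) = site k X + site k Y :=
  tensorMat_update_add _ k X Y

lemma site_smul (k : Fin n) (c : ℂ) (X : Matrix (ι k) (ι k) ℂ) : site k (c • X) = c • site k X :=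
  tensorMat_update_smul _ k c X

lemma site_one (k : Fin n) : site k (1 : Matrix (ι k) (ι k) ℂ) = 1 := by
  rw [site, Function.update_eq_self, tensorMat_one]

/-- `X ↦ site k X` as a linear map. -/
def siteLin (k : Fin n) : Matrix (ι k) (ι k) ℂ →ₗ[ℂ] Matrix (∀ k, ι k) (∀ k, ι k) ℂ where
  toFun := site k
  map_add' := site_add k
  map_smul' c X := by simpa using site_smul k c X

lemma site_sub (k : Fin n) (X Y : Matrix (ι k) (ι k) ℂ) : site k (X - Y) = site k X - site k Y :=
  map_sub (siteLin k) X Y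

lemma site_sum {α : Type} (s : Finset α) (k : Fin n) (X : α → Matrix (ι k) (ι k) ℂ) :
    site k (∑ a ∈ s, X a) = ∑ a ∈ s, site k (X a) :=
  map_sum (siteLin k) X s

lemma site_conjTranspose (k : Fin n) (X : Matrix (ι k) (ι k) ℂ) : (site k X)ᴴ = site k Xᴴ := by
  rw [site, tensorMat_conjTranspose, site]
  congr 1
  ext1 l
  rcases eq_or_ne l k with rfl | h
  · simp
  · simp [Function.update_of_ne h]

lemma site_mulVec_apply (k : Fin n) (X : Matrix (ι k) (ι k) ℂ) (φ : (∀ k, ι k) → ℂ)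
    (i : ∀ k, ι k) :
    (site k X *ᵥ φ) i = ∑ j, X (i k) j * φ (Function.update i k j) := by
  have hinj : Function.Injective (fun j => Function.update i k j) := Function.update_injective i k
  rw [Matrix.mulVec, dotProduct]
  symm
  refine Fintype.sum_of_injective _ hinj _ _ ?_ ?_
  · intro i' hi'
    rw [site, tensorMat_update_apply]
    have : ∃ l ∈ Finset.univ.erase k, i l ≠ i' l := by
      by_contra! hcon
      refine hi' ⟨i' k, ?_⟩
      ext l
      rcases eq_or_ne l k with rfl | h
      · simp
      · exact (Function.update_of_ne h _ _).trans (hcon l (by simp [h]))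
    obtain ⟨l, hl, hne⟩ := this
    have h0 : ∏ l ∈ Finset.univ.erase k, (1 : Matrix (ι l) (ι l) ℂ) (i l) (i' l) = 0 :=
      Finset.prod_eq_zero hl (Matrix.one_apply_ne hne)
    rw [h0, mul_zero, zero_mul]
  · intro j
    rw [site, tensorMat_update_apply, Function.update_self, Finset.prod_eq_one, mul_one]
    intro l hl
    rw [Function.update_of_ne (Finset.ne_of_mem_erase hl), Matrix.one_apply_eq]

end Tensor

/-! ### The Slater state as the determinant representation of `gl_d`. -/

section Slater

variable {d : ℕ}

/-- The action of `X ∈ gl_d` on `(ℂ^d)^{⊗ d}` by derivations. -/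
def derivAct (X : Matrix (Fin d) (Fin d) ℂ) : Matrix (Fin d → Fin d) (Fin d → Fin d) ℂ :=
  ∑ k : Fin d, site (ι := fun _ : Fin d => Fin d) k X

lemma derivAct_add (X Y : Matrix (Fin d) (Fin d) ℂ) :
    derivAct (X + Y) = derivAct X + derivAct Y := by
  simp only [derivAct, site_add, Finset.sum_add_distrib]

lemma derivAct_smul (c : ℂ) (X : Matrix (Fin d) (Fin d) ℂ) :
    derivAct (c • X) = c • derivAct X := by
  simp only [derivAct, site_smul, Finset.smul_sum]

lemma derivAct_one : derivAct (1 : Matrix (Fin d) (Fin d) ℂ) = (d : ℂ) • 1 := by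
  simp only [derivAct]
  rw [Finset.sum_congr rfl fun k _ => site_one (ι := fun _ : Fin d => Fin d) k]
  simp [Nat.cast_smul_eq_nsmul]

/-- In a product of two derivations the terms on distinct factors commute, so they cancel in the
commutator and only the same-factor terms survive. -/
lemma derivAct_commutator (X Y : Matrix (Fin d) (Fin d) ℂ) :
    derivAct (X * Y - Y * X) = derivAct X * derivAct Y - derivAct Y * derivAct X := by
  have h : ∀ A B : Matrix (Fin d) (Fin d) ℂ, derivAct A * derivAct B =
      ∑ k, (site (ι := fun _ : Fin d => Fin d) k (A * B) +
        ∑ l ∈ Finset.univ.erase k, site (ι := fun _ : Fin d => Fin d) k A * site l B) := by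
    intro A B
    rw [derivAct, derivAct, Finset.sum_mul]
    refine Finset.sum_congr rfl fun k _ => ?_
    rw [Finset.mul_sum, ← Finset.add_sum_erase _ _ (Finset.mem_univ k), site_mul]
  have h2 : ∑ k, ∑ l ∈ Finset.univ.erase k,
        site (ι := fun _ : Fin d => Fin d) k X * site (ι := fun _ : Fin d => Fin d) l Y =
      ∑ k, ∑ l ∈ Finset.univ.erase k,
        site (ι := fun _ : Fin d => Fin d) k Y * site (ι := fun _ : Fin d => Fin d) l X := by
    rw [Finset.sum_comm' (t' := Finset.univ) (s' := fun l => Finset.univ.erase l)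
      (by simp [eq_comm])]
    refine Finset.sum_congr rfl fun k _ => Finset.sum_congr rfl fun l hl => ?_
    exact site_comm (ι := fun _ : Fin d => Fin d) (Finset.ne_of_mem_erase hl) X Y
  rw [h, h, Finset.sum_add_distrib, Finset.sum_add_distrib, h2, add_sub_add_right_eq_sub,
    ← Finset.sum_sub_distrib, derivAct]
  exact Finset.sum_congr rfl fun k _ => site_sub (ι := fun _ : Fin d => Fin d) k _ _

lemma derivAct_mulVec_apply (X : Matrix (Fin d) (Fin d) ℂ) (φ : (Fin d → Fin d) → ℂ)
    (i : Fin d → Fin d) :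
    (derivAct X *ᵥ φ) i = ∑ k, ∑ j, X (i k) j * φ (Function.update i k j) := by
  rw [derivAct, Matrix.sum_mulVec, Finset.sum_apply]
  exact Finset.sum_congr rfl fun k _ => site_mulVec_apply (ι := fun _ : Fin d => Fin d) k X φ i

lemma slater_eq_zero {i : Fin d → Fin d} (hi : ¬ Function.Injective i) : slater d i = 0 := by
  unfold slater
  rw [Finset.sum_eq_zero, mul_zero]
  intro σ _
  rw [if_neg (fun h : i = σ => hi (by rw [h]; exact σ.injective)), mul_zero]

lemma slater_comp (i : Fin d → Fin d) (τ : Equiv.Perm (Fin d)) :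
    slater d (i ∘ τ) = ((Equiv.Perm.sign τ : ℤ) : ℂ) * slater d i := by
  by_cases hi : Function.Injective i
  · obtain ⟨σ, rfl⟩ : ∃ σ : Equiv.Perm (Fin d), i = σ :=
      ⟨Equiv.ofBijective i (Finite.injective_iff_bijective.mp hi), rfl⟩
    rw [← Equiv.Perm.coe_mul, slater_perm, slater_perm, Equiv.Perm.sign_mul]
    push_cast
    ring
  · rw [slater_eq_zero hi, slater_eq_zero, mul_zero]
    intro h
    refine hi fun x y hxy => ?_
    have := h (a₁ := τ.symm x) (a₂ := τ.symm y) (by simpa using hxy)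
    simpa using this

/-- The Slater state spans a one-dimensional representation of `gl_d`, given by the trace. -/
lemma derivAct_slater (X : Matrix (Fin d) (Fin d) ℂ) :
    derivAct X *ᵥ slater d = X.trace • slater d := by
  ext i
  rw [derivAct_mulVec_apply, Pi.smul_apply, smul_eq_mul]
  by_cases hi : Function.Injective i
  · have h : ∀ k, ∑ j, X (i k) j * slater d (Function.update i k j) =
        X (i k) (i k) * slater d i := by
      intro k
      rw [Finset.sum_eq_single (i k)]
      · rw [Function.update_eq_self]
      · intro j _ hj
        rw [slater_eq_zero, mul_zero]
        intro hinj
        -- An injective `i` already takes the value `j` at some other position, so writing `j` at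
        -- `k` creates a repetition.
        obtain ⟨l, rfl⟩ := (Finite.injective_iff_surjective.mp hi) j
        have hlk : l ≠ k := fun h => hj (by rw [h])
        exact hlk (hinj (by rw [Function.update_self, Function.update_of_ne hlk]))
      · simp
    rw [Finset.sum_congr rfl fun k _ => h k, ← Finset.sum_mul, Matrix.trace]
    congr 1
    exact Equiv.sum_comp (Equiv.ofBijective i (Finite.injective_iff_bijective.mp hi))
      (fun j => X j j)
  · rw [slater_eq_zero hi, mul_zero]
    obtain ⟨a, b, hab, hne⟩ : ∃ a b, i a = i b ∧ a ≠ b := by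
      simpa [Function.Injective] using hi
    have hsw : i ∘ Equiv.swap a b = i := by
      ext x
      by_cases hxa : x = a
      · subst hxa; simp [hab]
      · by_cases hxb : x = b
        · subst hxb; simp [hab]
        · simp [Equiv.swap_apply_of_ne_of_ne hxa hxb]
    -- Reindexing by the transposition, which fixes `i`, turns the sum into its negative.
    have hF : ∑ k, ∑ j, X (i k) j * slater d (Function.update i k j) =
        -∑ k, ∑ j, X (i k) j * slater d (Function.update i k j) := by
      conv_lhs => rw [← Equiv.sum_comp (Equiv.swap a b)]
      rw [← Finset.sum_neg_distrib]
      refine Finset.sum_congr rfl fun k _ => ?_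
      rw [← Finset.sum_neg_distrib]
      refine Finset.sum_congr rfl fun j _ => ?_
      have h1 : i (Equiv.swap a b k) = i k := congrFun hsw k
      have h2 : Function.update i (Equiv.swap a b k) j =
          Function.update i k j ∘ Equiv.swap a b := by
        ext x
        have h3 : x = Equiv.swap a b k ↔ Equiv.swap a b x = k :=
          (Equiv.swap_apply_eq_iff (x := a) (y := b)).symm
        have h4 : i (Equiv.swap a b x) = i x := congrFun hsw x
        simp only [Function.comp_apply, Function.update_apply, h3, h4]
      rw [h1, h2, slater_comp, Equiv.Perm.sign_swap hne]
      push_cast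
      ring
    exact self_eq_neg.mp hF

lemma eq_smul_slater_of_alternating {φ : (Fin d → Fin d) → ℂ}
    (h0 : ∀ i, ¬ Function.Injective i → φ i = 0)
    (hsw : ∀ (σ : Equiv.Perm (Fin d)) (a b : Fin d), a ≠ b → φ (σ ∘ Equiv.swap a b) = -φ σ) :
    ∃ c : ℂ, φ = c • slater d := by
  have hs : ∀ σ : Equiv.Perm (Fin d), φ σ = ((Equiv.Perm.sign σ : ℤ) : ℂ) * φ id := by
    intro σ
    induction σ using Equiv.Perm.swap_induction_on' with
    | one => simp
    | mul_swap f x y hxy ih =>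
      rw [Equiv.Perm.coe_mul, hsw f x y hxy, ih, Equiv.Perm.sign_mul, Equiv.Perm.sign_swap hxy]
      push_cast
      ring
  have hd : ((1 / Real.sqrt (d.factorial : ℝ) : ℝ) : ℂ) ≠ 0 := by
    rw [Complex.ofReal_ne_zero]
    have : (0 : ℝ) < d.factorial := by exact_mod_cast d.factorial_pos
    positivity
  refine ⟨φ id / ((1 / Real.sqrt (d.factorial : ℝ) : ℝ) : ℂ), ?_⟩
  ext i
  by_cases hi : Function.Injective i
  · obtain ⟨σ, rfl⟩ : ∃ σ : Equiv.Perm (Fin d), i = σ :=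
      ⟨Equiv.ofBijective i (Finite.injective_iff_bijective.mp hi), rfl⟩
    rw [Pi.smul_apply, slater_perm, hs, smul_eq_mul, ← mul_assoc, div_mul_cancel₀ _ hd, mul_comm]
  · rw [h0 i hi, Pi.smul_apply, slater_eq_zero hi, smul_zero]

/-- A vector on which `gl_d` acts through the trace is a multiple of the Slater state. -/
lemma eq_smul_slater_of_derivAct {φ : (Fin d → Fin d) → ℂ}
    (h : ∀ X : Matrix (Fin d) (Fin d) ℂ, derivAct X *ᵥ φ = X.trace • φ) :
    ∃ c : ℂ, φ = c • slater d := by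
  -- The hypothesis evaluated on the elementary matrix at `(p, q)`, which replaces one occurrence of
  -- `p` by `q` in all possible ways.
  have hE : ∀ (p q : Fin d) (i : Fin d → Fin d),
      ∑ k ∈ Finset.univ.filter (fun k => i k = p), φ (Function.update i k q) =
        (if p = q then 1 else 0) * φ i := by
    intro p q i
    have := congrFun (h (Matrix.single p q 1)) i
    rw [derivAct_mulVec_apply, Pi.smul_apply, smul_eq_mul] at this
    have htr : (Matrix.single p q (1 : ℂ)).trace = if p = q then 1 else 0 := by
      split_ifs with hpq
      · subst hpq; simp
      · exact Matrix.trace_single_eq_of_ne p q 1 hpq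
    rw [htr] at this
    rw [← this, Finset.sum_filter]
    refine Finset.sum_congr rfl fun k _ => ?_
    split_ifs with hk
    · rw [Finset.sum_eq_single q]
      · simp [hk]
      · intro j _ hj
        simp [hj.symm]
      · simp
    · symm
      refine Finset.sum_eq_zero fun j _ => ?_
      simp [Ne.symm hk]
  refine eq_smul_slater_of_alternating ?_ ?_
  · intro i hi
    by_contra hφ
    -- For `p = q` the operator counts the occurrences of `p` in `i`; trace one forces the count to
    -- be one wherever `φ i ≠ 0`.
    have hcard : ∀ p, (Finset.univ.filter (fun k => i k = p)).card = 1 := by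
      intro p
      have h1 := hE p p i
      rw [if_pos rfl, one_mul, Finset.sum_congr rfl (g := fun _ => φ i), Finset.sum_const,
        nsmul_eq_mul] at h1
      · have h2 := mul_right_cancel₀ hφ (h1.trans (one_mul _).symm)
        exact_mod_cast h2
      · intro k hk
        rw [← (Finset.mem_filter.mp hk).2, Function.update_eq_self]
    refine hi fun a b hab => ?_
    exact Finset.card_le_one.mp (hcard (i b)).le a (by simp [hab]) b (by simp)
  · intro σ a b hab
    -- The chosen index has the value `σ a` at both `a` and `b` and misses `σ b`. Restoring `σ b` at
    -- `b` gives `σ`, at `a` gives the swapped permutation, and the trace is zero.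
    have h1 := hE (σ a) (σ b) (Function.update σ b (σ a))
    have hpq : σ a ≠ σ b := fun h => hab (σ.injective h)
    have hfil : Finset.univ.filter (fun k => Function.update (⇑σ) b (σ a) k = σ a) = {a, b} := by
      ext k
      simp only [Finset.mem_filter, Finset.mem_univ, true_and, Finset.mem_insert,
        Finset.mem_singleton, Function.update_apply]
      split_ifs with hk
      · simp [hk]
      · simp [hk]
    rw [hfil, Finset.sum_pair hab, if_neg hpq, zero_mul] at h1
    have h2 : Function.update (Function.update (⇑σ) b (σ a)) b (σ b) = σ := by simp
    have h3 : Function.update (Function.update (⇑σ) b (σ a)) a (σ b) = σ ∘ Equiv.swap a b := by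
      ext k
      simp only [Function.update_apply, Function.comp_apply, Equiv.swap_apply_def]
      split_ifs <;> simp_all
    rw [h2, h3] at h1
    exact eq_neg_of_add_eq_zero_left h1

/-- The joint effect of the measurement `{Q, 1 - Q}` performed by all parties. -/
def outcomeMat (Q : Matrix (Fin d) (Fin d) ℂ) (a : Fin d → Fin 2) :
    Matrix (Fin d → Fin d) (Fin d → Fin d) ℂ :=
  tensorMat fun k => if a k = 0 then Q else 1 - Q

/-- The number of parties with outcome `0`. -/
def zeros {n : ℕ} (a : Fin n → Fin 2) : ℕ := (Finset.univ.filter fun k => a k = 0).card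

/-- For idempotent `Q`, outcome `0` at a party selects eigenvalue one of `Q` and outcome `1` selects
eigenvalue zero. Each joint effect therefore maps into an eigenspace of `derivAct Q`. -/
lemma derivAct_mul_outcomeMat {Q : Matrix (Fin d) (Fin d) ℂ} (hQ : IsIdempotentElem Q)
    (a : Fin d → Fin 2) : derivAct Q * outcomeMat Q a = (zeros a : ℂ) • outcomeMat Q a := by
  have h : ∀ k, site (ι := fun _ : Fin d => Fin d) k Q * outcomeMat Q a =
      (if a k = 0 then (1 : ℂ) else 0) • outcomeMat Q a := by
    intro k
    rw [outcomeMat, site_mul_tensorMat]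
    have : Q * (if a k = 0 then Q else 1 - Q) =
        (if a k = 0 then (1 : ℂ) else 0) • (if a k = 0 then Q else 1 - Q) := by
      split_ifs
      · rw [hQ.eq, one_smul]
      · rw [mul_sub, hQ.eq, mul_one, sub_self, zero_smul]
    rw [this, tensorMat_update_smul,
      Function.update_eq_self (f := fun k => if a k = 0 then Q else 1 - Q) k]
  rw [derivAct, Finset.sum_mul, Finset.sum_congr rfl fun k _ => h k, ← Finset.sum_smul, zeros]
  congr 1
  simp

lemma outcomeMat_mul_derivAct {Q : Matrix (Fin d) (Fin d) ℂ} (hQ : IsIdempotentElem Q)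
    (a : Fin d → Fin 2) : outcomeMat Q a * derivAct Q = (zeros a : ℂ) • outcomeMat Q a := by
  have h : ∀ k, outcomeMat Q a * site (ι := fun _ : Fin d => Fin d) k Q =
      (if a k = 0 then (1 : ℂ) else 0) • outcomeMat Q a := by
    intro k
    rw [outcomeMat, tensorMat_mul_site]
    have : (if a k = 0 then Q else 1 - Q) * Q =
        (if a k = 0 then (1 : ℂ) else 0) • (if a k = 0 then Q else 1 - Q) := by
      split_ifs
      · rw [hQ.eq, one_smul]
      · rw [sub_mul, hQ.eq, one_mul, sub_self, zero_smul]
    rw [this, tensorMat_update_smul,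
      Function.update_eq_self (f := fun k => if a k = 0 then Q else 1 - Q) k]
  rw [derivAct, Finset.mul_sum, Finset.sum_congr rfl fun k _ => h k, ← Finset.sum_smul, zeros]
  congr 1
  simp

lemma sum_outcomeMat (Q : Matrix (Fin d) (Fin d) ℂ) : ∑ a, outcomeMat Q a = 1 := by
  unfold outcomeMat
  rw [sum_tensorMat (ι := fun _ : Fin d => Fin d)
    (fun _ b => if b = (0 : Fin 2) then Q else 1 - Q)]
  simp only [Fin.sum_univ_two]
  simpa using tensorMat_one (ι := fun _ : Fin d => Fin d)

/-- The outcome with zeros exactly at the first `r` parties. -/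
def firstZeros (d r : ℕ) : Fin d → Fin 2 := fun k => if (k : ℕ) < r then 0 else 1

lemma zeros_comp {n : ℕ} (a : Fin n → Fin 2) (σ : Equiv.Perm (Fin n)) :
    zeros (a ∘ σ) = zeros a :=
  Finset.card_equiv σ (by simp)

lemma zeros_firstZeros {d r : ℕ} (h : r ≤ d) : zeros (firstZeros d r) = r := by
  have : (Finset.univ.filter fun k : Fin d => firstZeros d r k = 0) =
      Finset.univ.filter fun k : Fin d => (k : ℕ) < r := by
    ext k
    simp [firstZeros]
  rw [zeros, this, Fin.card_filter_val_lt, min_eq_right h]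

lemma symProj_eq (Q : Matrix (Fin d) (Fin d) ℂ) : symProj Q =
    ((d.choose Q.rank : ℂ) / (d.factorial : ℂ)) •
      ∑ σ : Equiv.Perm (Fin d), outcomeMat Q (firstZeros d Q.rank ∘ σ) := by
  rw [symProj, symmetrizer, smul_smul, mul_one_div]
  congr 1
  refine Finset.sum_congr rfl fun σ _ => ?_
  rw [outcomeMat]
  congr 1
  ext1 k
  simp [firstZeros]

lemma exists_perm_of_zeros_eq {n : ℕ} {a b : Fin n → Fin 2} (h : zeros a = zeros b) :
    ∃ τ : Equiv.Perm (Fin n), a = b ∘ τ := by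
  have e : {k // a k = 0} ≃ {k // b k = 0} := by
    refine Fintype.equivOfCardEq ?_
    rw [Fintype.card_subtype, Fintype.card_subtype]
    exact h
  refine ⟨e.extendSubtype, ?_⟩
  ext1 k
  by_cases hk : a k = 0
  · rw [hk]
    exact (e.extendSubtype_mem k hk).symm
  · have h1 := e.extendSubtype_not_mem k hk
    simp only [Function.comp_apply]
    omega

lemma rank_le_dim (Q : Matrix (Fin d) (Fin d) ℂ) : Q.rank ≤ d := by
  simpa using Q.rank_le_width

/-- A vector killed by all joint effects with a number of zeros different from `rank Q` lies in the
range of `symProj Q`. -/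
lemma mem_range_symProj {Q : Matrix (Fin d) (Fin d) ℂ} {φ : (Fin d → Fin d) → ℂ}
    (h : ∀ a, zeros a ≠ Q.rank → outcomeMat Q a *ᵥ φ = 0) :
    φ ∈ Set.range (symProj Q).mulVec := by
  classical
  set g : (Fin d → Fin 2) → ((Fin d → Fin d) → ℂ) := fun a => outcomeMat Q a *ᵥ φ with hg
  set A := Finset.univ.filter fun a : Fin d → Fin 2 => zeros a = Q.rank with hA
  have hsum : ∑ a ∈ A, g a = φ := by
    have h1 : ∑ a, g a = φ := by
      rw [hg, ← Matrix.sum_mulVec, sum_outcomeMat, Matrix.one_mulVec]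
    rw [← h1]
    refine Finset.sum_subset (Finset.subset_univ _) fun a _ ha => h a ?_
    simpa [hA] using ha
  have hsum' : ∀ σ : Equiv.Perm (Fin d), ∑ a ∈ A, g (a ∘ σ) = φ := by
    intro σ
    rw [← hsum]
    refine Finset.sum_bij' (fun a _ => a ∘ σ) (fun a _ => a ∘ σ.symm) ?_ ?_ ?_ ?_ ?_
    · intro a ha
      simpa [hA, zeros_comp] using ha
    · intro a ha
      simpa [hA, zeros_comp] using ha
    · intro a _
      ext x
      simp
    · intro a _
      ext x
      simp
    · intro a _
      rfl
  -- The outcomes with `Q.rank` zeros form a single orbit of the permutations, so each has the same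
  -- orbit sum.
  have horb : ∀ a ∈ A, ∑ σ : Equiv.Perm (Fin d), g (a ∘ σ) =
      ∑ σ : Equiv.Perm (Fin d), g (firstZeros d Q.rank ∘ σ) := by
    intro a ha
    obtain ⟨τ, rfl⟩ := exists_perm_of_zeros_eq (a := a) (b := firstZeros d Q.rank)
      (by rw [zeros_firstZeros (rank_le_dim Q)]; simpa [hA] using ha)
    exact Fintype.sum_equiv (Equiv.mulLeft τ) _ _ fun σ => rfl
  have hcard : (A.card : ℂ) • ∑ σ : Equiv.Perm (Fin d), g (firstZeros d Q.rank ∘ σ) =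
      (d.factorial : ℂ) • φ := by
    rw [Nat.cast_smul_eq_nsmul, ← Finset.sum_const, ← Finset.sum_congr rfl horb, Finset.sum_comm,
      Finset.sum_congr rfl fun σ _ => hsum' σ, Finset.sum_const, Finset.card_univ,
      Fintype.card_perm, Fintype.card_fin, Nat.cast_smul_eq_nsmul]
  have hf : (d.factorial : ℂ) ≠ 0 := by exact_mod_cast d.factorial_ne_zero
  have hc : (d.choose Q.rank : ℂ) ≠ 0 := by
    exact_mod_cast (Nat.choose_pos (rank_le_dim Q)).ne'
  -- The vector is its own preimage up to a scalar. The scalar is in fact one, but leaving `A.card`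
  -- in it makes the count of outcomes unnecessary.
  refine ⟨((A.card : ℂ) / (d.choose Q.rank : ℂ)) • φ, ?_⟩
  have h2 : symProj Q *ᵥ φ = ((d.choose Q.rank : ℂ) / (d.factorial : ℂ)) •
      ∑ σ : Equiv.Perm (Fin d), g (firstZeros d Q.rank ∘ σ) := by
    rw [symProj_eq, Matrix.smul_mulVec, Matrix.sum_mulVec]
  rw [Matrix.mulVec_smul, h2, smul_smul]
  have h3 : (A.card : ℂ) / (d.choose Q.rank : ℂ) * ((d.choose Q.rank : ℂ) / (d.factorial : ℂ)) =
      (d.factorial : ℂ)⁻¹ * A.card := by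
    field_simp
  rw [h3, mul_smul, hcard, smul_smul, inv_mul_cancel₀ hf, one_smul]

lemma derivAct_of_mem_range_symProj {Q : Matrix (Fin d) (Fin d) ℂ} (hQ : IsIdempotentElem Q)
    {φ : (Fin d → Fin d) → ℂ} (h : φ ∈ Set.range (symProj Q).mulVec) :
    derivAct Q *ᵥ φ = (Q.rank : ℂ) • φ := by
  obtain ⟨v, rfl⟩ := h
  rw [Matrix.mulVec_mulVec, ← Matrix.smul_mulVec, symProj_eq, mul_smul_comm, Finset.mul_sum,
    smul_comm]
  refine congrArg (fun M => ((_ : ℂ) • M) *ᵥ v) ?_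
  rw [Finset.smul_sum]
  refine Finset.sum_congr rfl fun σ _ => ?_
  rw [derivAct_mul_outcomeMat hQ, zeros_comp, zeros_firstZeros (rank_le_dim Q)]

lemma trace_eq_rank {ι : Type} [Fintype ι] [DecidableEq ι] {Q : Matrix ι ι ℂ}
    (hQ : IsIdempotentElem Q) : Q.trace = Q.rank := by
  have h : IsIdempotentElem Q.toLin' := by
    rw [IsIdempotentElem, Module.End.mul_eq_comp, ← Matrix.toLin'_mul, hQ.eq]
  have h2 := (LinearMap.IsIdempotentElem.isProj_range _ h).trace
  rw [Matrix.trace_toLin'_eq] at h2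
  rw [h2, Matrix.rank_eq_finrank_range_toLin Q (Pi.basisFun ℂ ι) (Pi.basisFun ℂ ι)]
  rfl

/-- The Slater state is an eigenvector of `derivAct Q` with eigenvalue `Q.trace = Q.rank`, whereas
the effect sees only the eigenvalue `zeros a`. -/
lemma outcomeMat_slater {Q : Matrix (Fin d) (Fin d) ℂ} (hQ : IsIdempotentElem Q)
    {a : Fin d → Fin 2} (ha : zeros a ≠ Q.rank) : outcomeMat Q a *ᵥ slater d = 0 := by
  have h := congrArg (outcomeMat Q a *ᵥ ·) (derivAct_slater Q)
  simp only [Matrix.mulVec_mulVec, outcomeMat_mul_derivAct hQ, trace_eq_rank hQ,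
    Matrix.mulVec_smul, Matrix.smul_mulVec] at h
  have h2 : ((zeros a : ℂ) - Q.rank) • (outcomeMat Q a *ᵥ slater d) = 0 := by
    rw [sub_smul, h, sub_self]
  rcases smul_eq_zero.mp h2 with h3 | h3
  · exact absurd (by exact_mod_cast sub_eq_zero.mp h3) ha
  · exact h3

/-- `P` generates `gl_d` as a Lie algebra, up to scalar matrices. -/
def LieGenerates {N : ℕ} (P : Fin N → Matrix (Fin d) (Fin d) ℂ) : Prop :=
  ∀ L : Submodule ℂ (Matrix (Fin d) (Fin d) ℂ), 1 ∈ L → (∀ μ, P μ ∈ L) →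
    (∀ X ∈ L, ∀ Y ∈ L, X * Y - Y * X ∈ L) → L = ⊤

/-- The matrices acting on `φ` through the trace form a Lie subalgebra. It contains the identity,
and it contains each `P μ` because the range of `S_μ` lies in the eigenspace of `derivAct (P μ)` for
the eigenvalue `rank (P μ)`. -/
lemma slaterUnique_of_lieGenerates {N : ℕ} {P : Fin N → Matrix (Fin d) (Fin d) ℂ}
    (hP : ∀ μ, IsIdempotentElem (P μ)) (hL : LieGenerates P) : SlaterUnique P := by
  intro φ hφ
  let L : Submodule ℂ (Matrix (Fin d) (Fin d) ℂ) :=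
    { carrier := {X | derivAct X *ᵥ φ = X.trace • φ}
      add_mem' := by
        intro X Y (hX : derivAct X *ᵥ φ = X.trace • φ) (hY : derivAct Y *ᵥ φ = Y.trace • φ)
        change derivAct (X + Y) *ᵥ φ = (X + Y).trace • φ
        rw [derivAct_add, Matrix.add_mulVec, hX, hY, Matrix.trace_add, add_smul]
      zero_mem' := by
        change derivAct 0 *ᵥ φ = (0 : Matrix (Fin d) (Fin d) ℂ).trace • φ
        rw [← zero_smul ℂ (0 : Matrix (Fin d) (Fin d) ℂ), derivAct_smul]
        simp
      smul_mem' := by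
        intro c X (hX : derivAct X *ᵥ φ = X.trace • φ)
        change derivAct (c • X) *ᵥ φ = (c • X).trace • φ
        rw [derivAct_smul, Matrix.smul_mulVec, hX, Matrix.trace_smul, smul_assoc] }
  have htop : L = ⊤ := by
    refine hL L ?_ ?_ ?_
    · change derivAct 1 *ᵥ φ = (1 : Matrix (Fin d) (Fin d) ℂ).trace • φ
      rw [derivAct_one, Matrix.smul_mulVec, Matrix.one_mulVec, Matrix.trace_one, Fintype.card_fin]
    · intro μ
      change derivAct (P μ) *ᵥ φ = (P μ).trace • φ
      rw [derivAct_of_mem_range_symProj (hP μ) (hφ μ), trace_eq_rank (hP μ)]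
    · intro X (hX : derivAct X *ᵥ φ = X.trace • φ) Y (hY : derivAct Y *ᵥ φ = Y.trace • φ)
      change derivAct (X * Y - Y * X) *ᵥ φ = (X * Y - Y * X).trace • φ
      rw [derivAct_commutator, Matrix.sub_mulVec, ← Matrix.mulVec_mulVec, ← Matrix.mulVec_mulVec,
        hX, hY, Matrix.mulVec_smul, Matrix.mulVec_smul, hX, hY, Matrix.trace_sub,
        Matrix.trace_mul_comm X Y, sub_self, zero_smul, smul_comm, sub_self]
  refine eq_smul_slater_of_derivAct fun X => ?_
  have : X ∈ L := htop ▸ Submodule.mem_top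
  exact this

end Slater

/-! ### Isometries onto subspaces of `ℂ^m`. -/

section Isometry

/-- Every subspace of `ℂ^m` is the range of an isometry. -/
lemma exists_isometry_of_submodule {m : ℕ} (K : Submodule ℂ (Fin m → ℂ)) :
    ∃ W : Matrix (Fin m) (Fin (Module.finrank ℂ K)) ℂ, Wᴴ * W = 1 ∧
      (∀ v ∈ K, W *ᵥ (Wᴴ *ᵥ v) = v) ∧ ∀ j, (fun i => W i j) ∈ K := by
  set e := (WithLp.linearEquiv 2 ℂ (Fin m → ℂ)).symm with he
  set K' : Submodule ℂ (EuclideanSpace ℂ (Fin m)) := K.map e.toLinearMap with hK'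
  have hfin : Module.finrank ℂ K' = Module.finrank ℂ K := LinearEquiv.finrank_map_eq e K
  set b := (stdOrthonormalBasis ℂ K').reindex (finCongr hfin) with hb
  have hrep : ∀ (v : Fin m → ℂ) (j), (∑ i, star ((b j : EuclideanSpace ℂ (Fin m)) i) * v i) =
      inner ℂ (b j : EuclideanSpace ℂ (Fin m)) (e v) := by
    intro v j
    rw [PiLp.inner_apply]
    refine Finset.sum_congr rfl fun i _ => ?_
    rw [RCLike.inner_apply, mul_comm]
    rfl
  refine ⟨Matrix.of fun i j => (b j : EuclideanSpace ℂ (Fin m)) i, ?_, ?_, ?_⟩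
  · ext j k
    have h := orthonormal_iff_ite.mp b.orthonormal j k
    rw [Matrix.mul_apply, Matrix.one_apply, ← h, Submodule.coe_inner]
    exact hrep (fun i => (b k : EuclideanSpace ℂ (Fin m)) i) j
  · intro v hv
    have hv' : e v ∈ K' := Submodule.mem_map_of_mem hv
    have h := b.sum_repr' ⟨e v, hv'⟩
    have h2 := congrArg (fun u : K' => (u : EuclideanSpace ℂ (Fin m))) h
    ext i
    have h3 := congrArg (fun u : EuclideanSpace ℂ (Fin m) => u i) h2
    simp only [Submodule.coe_sum, Submodule.coe_smul, WithLp.ofLp_sum, Finset.sum_apply,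
      WithLp.ofLp_smul, Pi.smul_apply, smul_eq_mul] at h3
    refine Eq.trans ?_ h3
    rw [Matrix.mulVec, dotProduct]
    refine Finset.sum_congr rfl fun j _ => ?_
    rw [mul_comm]
    congr 1
    rw [Submodule.coe_inner, ← hrep v j]
    rfl
  · intro j
    obtain ⟨v, hv, h⟩ := (Submodule.mem_map).mp (b j).2
    convert hv using 1
    ext i
    rw [Matrix.of_apply, ← h]
    rfl

/-- The column space of a matrix is the range of an isometry `W`. -/
lemma exists_isometry_of_matrix {m : ℕ} {κ : Type} [Fintype κ] [DecidableEq κ]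
    (M : Matrix (Fin m) κ ℂ) :
    ∃ (n : ℕ) (W : Matrix (Fin m) (Fin n) ℂ), Wᴴ * W = 1 ∧ W * Wᴴ * M = M ∧
      ∀ X : Matrix (Fin m) (Fin m) ℂ, X * M = 0 → X * W = 0 := by
  obtain ⟨W, h1, h2, h3⟩ := exists_isometry_of_submodule (Submodule.span ℂ (Set.range M.col))
  refine ⟨_, W, h1, ?_, ?_⟩
  · ext i j
    have := congrFun (h2 (M.col j) (Submodule.subset_span ⟨j, rfl⟩)) i
    rw [Matrix.mulVec_mulVec] at this
    exact this
  · intro X hX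
    have hle : Submodule.span ℂ (Set.range M.col) ≤ LinearMap.ker X.mulVecLin := by
      rw [Submodule.span_le]
      rintro _ ⟨j, rfl⟩
      change X *ᵥ M.col j = 0
      ext i
      exact congrFun (congrFun hX i) j
    ext i j
    have h4 : X *ᵥ (fun i => W i j) = 0 := hle (h3 j)
    exact congrFun h4 i

/-- The orthogonal complement of the range of an isometry is the range of an isometry. -/
lemma exists_isometry_compl {n d : ℕ} (T : Matrix (Fin n) (Fin d) ℂ) (hT : Tᴴ * T = 1) :
    ∃ (n' : ℕ) (W : Matrix (Fin n) (Fin n') ℂ), Wᴴ * W = 1 ∧ W * Wᴴ = 1 - T * Tᴴ ∧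
      n' + d = n := by
  obtain ⟨n', W, h1, h2, h3⟩ := exists_isometry_of_matrix (1 - T * Tᴴ)
  have h4 : Tᴴ * W = 0 := by
    -- A left annihilator of `1 - T Tᴴ` annihilates `W`, which makes the two ranges orthogonal.
    have : (T * Tᴴ) * (1 - T * Tᴴ) = 0 := by
      rw [mul_sub, mul_one, Matrix.mul_assoc, ← Matrix.mul_assoc Tᴴ, hT, Matrix.one_mul, sub_self]
    have h5 := congrArg (Tᴴ * ·) (h3 _ this)
    simpa [← Matrix.mul_assoc, hT] using h5
  have h5 : Wᴴ * T = 0 := by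
    simpa using congrArg Matrix.conjTranspose h4
  have h6 : W * Wᴴ = 1 - T * Tᴴ := by
    rw [← h2, mul_sub, mul_one, Matrix.mul_assoc W, ← Matrix.mul_assoc Wᴴ, h5, Matrix.zero_mul,
      Matrix.mul_zero, sub_zero]
  refine ⟨n', W, h1, h6, ?_⟩
  have h7 := congrArg Matrix.trace h6
  rw [Matrix.trace_mul_comm, h1, Matrix.trace_sub, Matrix.trace_mul_comm, hT] at h7
  simp only [Matrix.trace_one, Fintype.card_fin] at h7
  have h8 : ((n' + d : ℕ) : ℂ) = n := by
    push_cast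
    rw [h7]
    ring
  exact_mod_cast h8

end Isometry

/-! ### Projection families and a lower bound for their intertwiners. -/

section Intertwiner

variable {N n d : ℕ} {x : ℚ}

lemma IsProjFamily.idem {P : Fin N → Matrix (Fin d) (Fin d) ℂ} (hP : IsProjFamily x P) (μ) :
    P μ * P μ = P μ := (hP.isProj μ).isIdempotentElem

lemma IsProjFamily.herm {P : Fin N → Matrix (Fin d) (Fin d) ℂ} (hP : IsProjFamily x P) (μ) :
    (P μ)ᴴ = P μ := (hP.isProj μ).isSelfAdjoint

/-- Idempotence and the sum relation are asked only on the range of `W`; this suits POVM effects,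
which are controlled only on the local support of the state. -/
lemma isProjFamily_compress {Q : Fin N → Matrix (Fin n) (Fin n) ℂ}
    {W : Matrix (Fin n) (Fin d) ℂ} (hW : Wᴴ * W = 1) (hherm : ∀ μ, (Q μ)ᴴ = Q μ)
    (hidem : ∀ μ, Q μ * (Q μ * W) = Q μ * W) (hinv : ∀ μ, W * (Wᴴ * (Q μ * W)) = Q μ * W)
    (hsum : (∑ μ, Q μ) * W = (x : ℂ) • W) : IsProjFamily x fun μ => Wᴴ * (Q μ * W) where
  isProj μ := by
    refine ⟨?_, ?_⟩
    · rw [IsIdempotentElem, Matrix.mul_assoc, Matrix.mul_assoc, hinv, hidem]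
    · rw [IsSelfAdjoint, Matrix.star_eq_conjTranspose]
      simp [Matrix.mul_assoc, hherm]
  sum_eq := by
    rw [← Matrix.mul_sum, ← Matrix.sum_mul, hsum, Matrix.mul_smul, hW]

lemma IsProjFamily.sum_rank {P : Fin N → Matrix (Fin d) (Fin d) ℂ} (hP : IsProjFamily x P) :
    ∑ μ, ((P μ).rank : ℚ) = x * d := by
  have h := congrArg Matrix.trace hP.sum_eq
  rw [Matrix.trace_sum, Finset.sum_congr rfl fun μ _ => trace_eq_rank (hP.idem μ),
    Matrix.trace_smul, Matrix.trace_one, Fintype.card_fin, smul_eq_mul] at h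
  exact_mod_cast h

/-- `T ↦ A T B` as a linear map. -/
def mulLeftRight (A : Matrix (Fin n) (Fin n) ℂ) (B : Matrix (Fin d) (Fin d) ℂ) :
    Matrix (Fin n) (Fin d) ℂ →ₗ[ℂ] Matrix (Fin n) (Fin d) ℂ where
  toFun T := A * T * B
  map_add' S T := by rw [Matrix.mul_add, Matrix.add_mul]
  map_smul' c T := by simp

lemma trace_mulLeftRight (A : Matrix (Fin n) (Fin n) ℂ) (B : Matrix (Fin d) (Fin d) ℂ) :
    LinearMap.trace ℂ _ (mulLeftRight A B) = A.trace * B.trace := by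
  rw [LinearMap.trace_eq_matrix_trace ℂ (Matrix.stdBasis ℂ (Fin n) (Fin d)), Matrix.trace,
    Fintype.sum_prod_type, Matrix.trace, Matrix.trace, Finset.sum_mul_sum]
  refine Finset.sum_congr rfl fun i _ => Finset.sum_congr rfl fun j _ => ?_
  rw [Matrix.diag_apply, LinearMap.toMatrix_apply, Matrix.stdBasis_eq_single]
  have : ∀ M : Matrix (Fin n) (Fin d) ℂ, (Matrix.stdBasis ℂ (Fin n) (Fin d)).repr M (i, j) =
      M i j := by
    intro M
    simp [Matrix.stdBasis]
  rw [this]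
  change (A * Matrix.single i j (1 : ℂ) * B : Matrix (Fin n) (Fin d) ℂ) i j = _
  simp [Matrix.mul_apply, Matrix.single_apply, ite_and]

/-- `T ↦ Q T - T P`, whose kernel consists of the intertwiners between `P` and `Q`. -/
def intertwineDefect (Q : Matrix (Fin n) (Fin n) ℂ) (P : Matrix (Fin d) (Fin d) ℂ) :
    Matrix (Fin n) (Fin d) ℂ →ₗ[ℂ] Matrix (Fin n) (Fin d) ℂ :=
  mulLeftRight Q 1 - mulLeftRight 1 P

lemma intertwineDefect_apply (Q : Matrix (Fin n) (Fin n) ℂ) (P : Matrix (Fin d) (Fin d) ℂ)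
    (T : Matrix (Fin n) (Fin d) ℂ) : intertwineDefect Q P T = Q * T - T * P := by
  simp [intertwineDefect, mulLeftRight]

lemma intertwineDefect_sq {Q : Matrix (Fin n) (Fin n) ℂ} {P : Matrix (Fin d) (Fin d) ℂ}
    (hQ : Q * Q = Q) (hP : P * P = P) (T : Matrix (Fin n) (Fin d) ℂ) :
    intertwineDefect Q P (intertwineDefect Q P T) = Q * T - (2 : ℂ) • (Q * T * P) + T * P := by
  simp only [intertwineDefect_apply, Matrix.mul_sub, Matrix.sub_mul]
  rw [← Matrix.mul_assoc, hQ, Matrix.mul_assoc T, hP, ← Matrix.mul_assoc, two_smul]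
  abel

/-- Left multiplication by `Q` and right multiplication by `P` are commuting idempotents, so their
difference has eigenvalues in `{0, 1, -1}`. -/
lemma intertwineDefect_cube {Q : Matrix (Fin n) (Fin n) ℂ} {P : Matrix (Fin d) (Fin d) ℂ}
    (hQ : Q * Q = Q) (hP : P * P = P) (T : Matrix (Fin n) (Fin d) ℂ) :
    intertwineDefect Q P (intertwineDefect Q P (intertwineDefect Q P T)) =
      intertwineDefect Q P T := by
  have hQ' : ∀ A : Matrix (Fin n) (Fin d) ℂ, Q * (Q * A) = Q * A := fun A => by
    rw [← Matrix.mul_assoc, hQ]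
  rw [intertwineDefect_sq hQ hP]
  simp only [intertwineDefect_apply, Matrix.mul_sub, Matrix.sub_mul, Matrix.mul_assoc, hP, hQ',
    two_smul]
  abel

/-- Since `f³ = f`, the square of `f` is idempotent with the same range as `f`, so the rank is the
trace of `f²`. -/
lemma finrank_range_intertwineDefect {Q : Matrix (Fin n) (Fin n) ℂ}
    {P : Matrix (Fin d) (Fin d) ℂ} (hQ : Q * Q = Q) (hP : P * P = P) :
    (Module.finrank ℂ (LinearMap.range (intertwineDefect Q P)) : ℤ) =
      Q.rank * d - 2 * (Q.rank * P.rank) + n * P.rank := by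
  set f := intertwineDefect Q P with hf
  have hidem : IsIdempotentElem (f ∘ₗ f) := by
    ext1 T
    change f (f (f (f T))) = f (f T)
    rw [intertwineDefect_cube hQ hP]
  have hrange : LinearMap.range (f ∘ₗ f) = LinearMap.range f := by
    refine le_antisymm (LinearMap.range_comp_le_range f f) ?_
    rintro _ ⟨T, rfl⟩
    exact ⟨f T, intertwineDefect_cube hQ hP T⟩
  have htr := (LinearMap.IsIdempotentElem.isProj_range _ hidem).trace
  have hff : f ∘ₗ f = mulLeftRight Q 1 - (2 : ℂ) • mulLeftRight Q P + mulLeftRight 1 P := by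
    ext1 T
    refine (intertwineDefect_sq hQ hP T).trans ?_
    simp [mulLeftRight]
  rw [hrange, hff, map_add, map_sub, map_smul, trace_mulLeftRight, trace_mulLeftRight,
    trace_mulLeftRight, trace_eq_rank hQ, trace_eq_rank hP] at htr
  simp only [Matrix.trace_one, Fintype.card_fin, smul_eq_mul] at htr
  exact_mod_cast htr.symm

/-- The space of intertwiners `T`, `Q μ T = T P μ`. -/
def intertwiners (Q : Fin N → Matrix (Fin n) (Fin n) ℂ) (P : Fin N → Matrix (Fin d) (Fin d) ℂ) :
    Submodule ℂ (Matrix (Fin n) (Fin d) ℂ) :=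
  ⨅ μ, LinearMap.ker (intertwineDefect (Q μ) (P μ))

lemma mem_intertwiners {Q : Fin N → Matrix (Fin n) (Fin n) ℂ}
    {P : Fin N → Matrix (Fin d) (Fin d) ℂ} {T : Matrix (Fin n) (Fin d) ℂ} :
    T ∈ intertwiners Q P ↔ ∀ μ, Q μ * T = T * P μ := by
  simp [intertwiners, Submodule.mem_iInf, intertwineDefect_apply, sub_eq_zero]

lemma trace_intertwineDefect_adjoint {Q : Matrix (Fin n) (Fin n) ℂ} {P : Matrix (Fin d) (Fin d) ℂ}
    (hQ : Qᴴ = Q) (hP : Pᴴ = P) (A B : Matrix (Fin n) (Fin d) ℂ) :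
    (Aᴴ * intertwineDefect Q P B).trace = ((intertwineDefect Q P A)ᴴ * B).trace := by
  simp only [intertwineDefect_apply, Matrix.conjTranspose_sub, Matrix.conjTranspose_mul, hQ, hP,
    Matrix.mul_sub, Matrix.sub_mul, Matrix.trace_sub]
  rw [← Matrix.mul_assoc, ← Matrix.mul_assoc, Matrix.trace_mul_comm (Aᴴ * B), ← Matrix.mul_assoc]

/-- Rank-nullity for a map on pairs `(S, T)` whose kernel is exactly two copies of the intertwiners
and whose target is the product of the ranges of the defects. The factor two comes from using pairs:
the relation `∑ μ, f μ = 0`, which reflects the common weight, keeps the kernel from being larger.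
-/
lemma two_mul_le_finrank_intertwiners {Q : Fin N → Matrix (Fin n) (Fin n) ℂ}
    {P : Fin N → Matrix (Fin d) (Fin d) ℂ} (hQ : IsProjFamily x Q) (hP : IsProjFamily x P) :
    2 * ((n : ℤ) * d) ≤ 2 * Module.finrank ℂ (intertwiners Q P) +
      ∑ μ, ((Q μ).rank * d - 2 * ((Q μ).rank * (P μ).rank) + n * (P μ).rank : ℤ) := by
  set f := fun μ => intertwineDefect (Q μ) (P μ) with hf
  have hcube : ∀ μ T, f μ (f μ (f μ T)) = f μ T := fun μ T =>
    intertwineDefect_cube (hQ.idem μ) (hP.idem μ) T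
  have hsum : ∀ T, ∑ μ, f μ T = 0 := by
    intro T
    simp only [hf, intertwineDefect_apply, Finset.sum_sub_distrib]
    rw [← Matrix.sum_mul, ← Matrix.mul_sum, hQ.sum_eq, hP.sum_eq]
    simp
  let Φ : (Matrix (Fin n) (Fin d) ℂ × Matrix (Fin n) (Fin d) ℂ) →ₗ[ℂ]
      (∀ μ, LinearMap.range (f μ)) :=
    LinearMap.pi fun μ => (f μ).rangeRestrict ∘ₗ LinearMap.coprod LinearMap.id (f μ)
  have hΦ : ∀ S T μ, ((Φ (S, T) μ : LinearMap.range (f μ)) : Matrix (Fin n) (Fin d) ℂ) =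
      f μ (S + f μ T) := fun S T μ => rfl
  have hker : LinearMap.ker Φ = (intertwiners Q P).prod (intertwiners Q P) := by
    ext ⟨S, T⟩
    rw [LinearMap.mem_ker, Submodule.mem_prod]
    have hmem : ∀ T, T ∈ intertwiners Q P ↔ ∀ μ, f μ T = 0 := by
      intro T
      simp [hf, intertwiners, Submodule.mem_iInf]
    simp only [hmem]
    constructor
    · intro h
      have h1 : ∀ μ, f μ (S + f μ T) = 0 := fun μ => by
        rw [← hΦ, h]; rfl
      -- Applying `f μ` and summing over `μ` removes `T`, because `f μ ^ 3 = f μ` and the defects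
      -- sum to zero.
      have h2 : ∑ μ, f μ (f μ S) = 0 := by
        have h3 : ∑ μ, f μ (f μ (S + f μ T)) = 0 :=
          Finset.sum_eq_zero fun μ _ => by rw [h1, map_zero]
        simpa only [map_add, hcube, Finset.sum_add_distrib, hsum, add_zero] using h3
      -- The defects are self-adjoint for the Hilbert–Schmidt product, so this is a vanishing sum of
      -- squared norms.
      have h4 : ∑ μ, ((f μ S)ᴴ * f μ S).trace = 0 := by
        rw [← Finset.sum_congr rfl fun μ _ =>
          trace_intertwineDefect_adjoint (hQ.herm μ) (hP.herm μ) S (f μ S)]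
        rw [← Matrix.trace_sum, ← Matrix.mul_sum]
        refine (congrArg (fun A => (Sᴴ * A).trace) h2).trans ?_
        rw [Matrix.mul_zero, Matrix.trace_zero]
      have h5 : ∀ μ, f μ S = 0 := by
        intro μ
        have h6 := (Finset.sum_eq_zero_iff_of_nonneg fun μ _ =>
          (Matrix.posSemidef_conjTranspose_mul_self (f μ S)).trace_nonneg).mp h4 μ
          (Finset.mem_univ μ)
        exact Matrix.trace_conjTranspose_mul_self_eq_zero_iff.mp h6
      refine ⟨h5, fun μ => ?_⟩
      have h7 := h1 μ
      rw [map_add, h5, zero_add] at h7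
      rw [← hcube, h7, map_zero]
    · rintro ⟨hS, hT⟩
      ext1 μ
      refine Subtype.ext ?_
      rw [hΦ, hT, add_zero, hS]
      rfl
  have h1 := LinearMap.finrank_range_add_finrank_ker Φ
  have h2 : Module.finrank ℂ (LinearMap.range Φ) ≤
      ∑ μ, Module.finrank ℂ (LinearMap.range (f μ)) := by
    rw [← Module.finrank_pi_fintype]
    exact Submodule.finrank_le _
  have h3 : Module.finrank ℂ ((intertwiners Q P).prod (intertwiners Q P)) =
      Module.finrank ℂ (intertwiners Q P) + Module.finrank ℂ (intertwiners Q P) := by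
    rw [← Module.finrank_prod]
    exact LinearEquiv.finrank_eq
      { toFun := fun p => (⟨p.1.1, p.2.1⟩, ⟨p.1.2, p.2.2⟩)
        invFun := fun p => ⟨(p.1.1, p.2.1), p.1.2, p.2.2⟩
        map_add' := fun _ _ => rfl
        map_smul' := fun _ _ => rfl }
  rw [hker, h3, Module.finrank_prod, Module.finrank_matrix, Fintype.card_fin, Fintype.card_fin,
    Module.finrank_self, mul_one] at h1
  have h4 : ∑ μ, ((Q μ).rank * d - 2 * ((Q μ).rank * (P μ).rank) + n * (P μ).rank : ℤ) =
      ((∑ μ, Module.finrank ℂ (LinearMap.range (f μ)) : ℕ) : ℤ) := by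
    rw [Nat.cast_sum]
    exact Finset.sum_congr rfl fun μ _ =>
      (finrank_range_intertwineDefect (hQ.idem μ) (hP.idem μ)).symm
  rw [h4]
  have h5 : 2 * (n * d) ≤ 2 * Module.finrank ℂ (intertwiners Q P) +
      ∑ μ, Module.finrank ℂ (LinearMap.range (f μ)) := by omega
  exact_mod_cast h5

end Intertwiner

/-! ### Rigidity: families of weight `x` are multiples of a single one. -/

section Rigid

/-- `(d; r, …, r)` is a real root of the star with `N` arms, and `x` is the corresponding weight. -/
structure RigidParams (N d r : ℕ) (x : ℚ) : Prop where
  d_pos : 0 < d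
  x_mul : x * d = N * r
  form : (d : ℤ) ^ 2 + N * r ^ 2 = N * r * d + 1

variable {N n d r : ℕ} {x : ℚ}

/-- The form equation is a Bézout identity: `(d - N r) d + r (N r) = 1`. -/
lemma RigidParams.coprime (h : RigidParams N d r x) : Nat.Coprime d (N * r) := by
  rw [← Nat.isCoprime_iff_coprime]
  refine ⟨(d : ℤ) - N * r, r, ?_⟩
  push_cast
  linear_combination h.form

lemma RigidParams.mul_sum_rank (h : RigidParams N d r x) {Q : Fin N → Matrix (Fin n) (Fin n) ℂ}
    (hQ : IsProjFamily x Q) : (∑ μ, (Q μ).rank) * d = N * r * n := by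
  have h1 : ((∑ μ, (Q μ).rank : ℕ) : ℚ) = x * n := by
    rw [Nat.cast_sum]
    exact hQ.sum_rank
  have h2 : ((∑ μ, (Q μ).rank : ℕ) : ℚ) * d = N * r * n := by
    rw [h1, mul_right_comm, h.x_mul]
  exact_mod_cast h2

/-- Traces give `(∑ μ, rank (Q μ)) d = N r n`. Applied to invariant subspaces, this excludes proper
nonzero subfamilies of a family on `ℂ^d`. -/
lemma RigidParams.dvd_dim (h : RigidParams N d r x) {Q : Fin N → Matrix (Fin n) (Fin n) ℂ}
    (hQ : IsProjFamily x Q) : d ∣ n :=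
  h.coprime.dvd_of_dvd_mul_left ⟨_, (h.mul_sum_rank hQ).symm.trans (mul_comm _ _)⟩

/-- Schur's lemma for a projection family with rigid parameters. -/
lemma RigidParams.schur (h : RigidParams N d r x) {P : Fin N → Matrix (Fin d) (Fin d) ℂ}
    (hP : IsProjFamily x P) {T : Matrix (Fin d) (Fin d) ℂ} (hT : ∀ μ, P μ * T = T * P μ) :
    ∃ c : ℂ, T = c • 1 := by
  have : Nonempty (Fin d) := ⟨⟨0, h.d_pos⟩⟩
  obtain ⟨c, hc⟩ := Module.End.exists_eigenvalue T.toLin'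
  set A := T - c • (1 : Matrix (Fin d) (Fin d) ℂ) with hA
  have hAP : ∀ μ, A * P μ = P μ * A := fun μ => by
    rw [hA, sub_mul, mul_sub, hT]
    simp
  -- The eigenspace is invariant under all `P μ`, so it carries a family of weight `x` and its
  -- dimension is a positive multiple of `d`.
  set K := LinearMap.ker A.mulVecLin with hK
  have hmem : ∀ v, v ∈ K ↔ A *ᵥ v = 0 := fun v => LinearMap.mem_ker
  obtain ⟨W, h1, h2, h3⟩ := exists_isometry_of_submodule K
  have hrep := isProjFamily_compress (Q := P) (x := x) h1 hP.herm
    (fun μ => by rw [← Matrix.mul_assoc, hP.idem]) (fun μ => by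
      ext i j
      have h4 : P μ *ᵥ (fun i => W i j) ∈ K := by
        rw [hmem, Matrix.mulVec_mulVec, hAP, ← Matrix.mulVec_mulVec, (hmem _).mp (h3 j),
          Matrix.mulVec_zero]
      have h5 := congrFun (h2 _ h4) i
      rw [Matrix.mulVec_mulVec, Matrix.mulVec_mulVec] at h5
      rw [← Matrix.mul_assoc, ← Matrix.mul_assoc]
      exact h5) (by rw [hP.sum_eq, Matrix.smul_mul, Matrix.one_mul])
  have hdvd := h.dvd_dim hrep
  obtain ⟨v, hv, hv0⟩ := hc.exists_hasEigenvector
  have hv' : v ∈ K := by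
    rw [hmem, hA, Matrix.sub_mulVec, Matrix.smul_mulVec, Matrix.one_mulVec, sub_eq_zero]
    have := Module.End.mem_eigenspace_iff.mp hv
    simpa using this
  have hpos : 0 < Module.finrank ℂ K := by
    rw [Module.finrank_pos_iff_exists_ne_zero]
    exact ⟨⟨v, hv'⟩, fun h0 => hv0 (congrArg Subtype.val h0)⟩
  have htop : K = ⊤ := by
    apply Submodule.eq_top_of_finrank_eq
    refine le_antisymm (Submodule.finrank_le K) ?_
    rw [Module.finrank_fin_fun]
    exact Nat.le_of_dvd hpos hdvd
  refine ⟨c, sub_eq_zero.mp ?_⟩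
  change A = 0
  have h6 : A.mulVecLin = 0 := LinearMap.ker_eq_top.mp htop
  ext i j
  have h7 := congrFun (LinearMap.congr_fun h6 (Pi.single j 1)) i
  simpa using h7

/-- By Schur the self-intertwiners have dimension at most one. The Euler-form bound then reads `∑ μ,
rank (P μ) ^ 2 ≤ N r²`, and since the ranks sum to `N r`, they must all equal `r`. -/
lemma RigidParams.rank_eq (h : RigidParams N d r x) {P : Fin N → Matrix (Fin d) (Fin d) ℂ}
    (hP : IsProjFamily x P) (μ : Fin N) : (P μ).rank = r := by
  have h1 := two_mul_le_finrank_intertwiners hP hP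
  have h2 : Module.finrank ℂ (intertwiners P P) ≤ 1 := by
    refine finrank_le_one (⟨1, mem_intertwiners.mpr fun μ => by simp⟩ : intertwiners P P) ?_
    rintro ⟨T, hT⟩
    obtain ⟨c, hc⟩ := h.schur hP (mem_intertwiners.mp hT)
    exact ⟨c, Subtype.ext hc.symm⟩
  have hd : (d : ℤ) ≠ 0 := by exact_mod_cast h.d_pos.ne'
  have h3 : ∑ μ, ((P μ).rank : ℤ) = N * r := by
    have h4 : (∑ μ, ((P μ).rank : ℤ)) * d = N * r * d := by exact_mod_cast h.mul_sum_rank hP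
    exact mul_right_cancel₀ hd h4
  have h5 : ∑ μ, (((P μ).rank : ℤ) - r) ^ 2 ≤ 0 := by
    have e1 : ∑ μ, ((P μ).rank * d - 2 * ((P μ).rank * (P μ).rank) + d * (P μ).rank : ℤ) =
        2 * d * ∑ μ, ((P μ).rank : ℤ) - 2 * ∑ μ, ((P μ).rank : ℤ) ^ 2 := by
      rw [Finset.mul_sum, Finset.mul_sum, ← Finset.sum_sub_distrib]
      exact Finset.sum_congr rfl fun μ _ => by ring
    have e2 : ∑ μ, (((P μ).rank : ℤ) - r) ^ 2 =
        ∑ μ, ((P μ).rank : ℤ) ^ 2 - 2 * r * ∑ μ, ((P μ).rank : ℤ) + N * r ^ 2 := by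
      have : (N : ℤ) * r ^ 2 = ∑ _μ : Fin N, (r : ℤ) ^ 2 := by simp
      rw [Finset.mul_sum, this, ← Finset.sum_sub_distrib, ← Finset.sum_add_distrib]
      exact Finset.sum_congr rfl fun μ _ => by ring
    rw [e1] at h1
    rw [e2]
    rw [h3] at h1 ⊢
    have h6 : (Module.finrank ℂ (intertwiners P P) : ℤ) ≤ 1 := by exact_mod_cast h2
    linarith [h.form]
  have h7 := (Finset.sum_eq_zero_iff_of_nonneg fun μ _ => sq_nonneg (((P μ).rank : ℤ) - r)).mp
    (le_antisymm h5 (Finset.sum_nonneg fun μ _ => sq_nonneg _)) μ (Finset.mem_univ μ)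
  have h8 := pow_eq_zero_iff (two_ne_zero) |>.mp h7
  omega

/-- Without a nonzero intertwiner the bound would give `2 n (d² - N r (d - r)) ≤ 0`, while the form
equation makes the bracket one. For a nonzero `T`, Schur's lemma makes `Tᴴ T` a positive scalar,
which is normalized away. -/
lemma RigidParams.exists_isometric_intertwiner (h : RigidParams N d r x)
    {P : Fin N → Matrix (Fin d) (Fin d) ℂ} (hP : IsProjFamily x P)
    {Q : Fin N → Matrix (Fin n) (Fin n) ℂ} (hQ : IsProjFamily x Q) (hn : 0 < n) :
    ∃ T : Matrix (Fin n) (Fin d) ℂ, Tᴴ * T = 1 ∧ ∀ μ, Q μ * T = T * P μ := by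
  have hd0 : (0 : ℤ) < d := by exact_mod_cast h.d_pos
  have hn0 : (0 : ℤ) < n := by exact_mod_cast hn
  obtain ⟨T, hT, hT0⟩ : ∃ T ∈ intertwiners Q P, T ≠ 0 := by
    rw [← Submodule.ne_bot_iff]
    intro hbot
    have h1 := two_mul_le_finrank_intertwiners hQ hP
    rw [hbot, finrank_bot, Finset.sum_congr rfl (g := fun μ =>
      ((Q μ).rank : ℤ) * (d - 2 * r) + n * r)
      (fun μ _ => by rw [h.rank_eq hP]; ring), Finset.sum_add_distrib, ← Finset.sum_mul] at h1
    have h2 : (∑ μ, ((Q μ).rank : ℤ)) * d = N * r * n := by exact_mod_cast h.mul_sum_rank hQ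
    simp only [Finset.sum_const, Finset.card_univ, Fintype.card_fin, nsmul_eq_mul, Nat.cast_zero,
      mul_zero, zero_add] at h1
    have h3 := mul_le_mul_of_nonneg_right h1 hd0.le
    have h4 : (∑ μ, ((Q μ).rank : ℤ)) * (d - 2 * r) * d = N * r * n * (d - 2 * r) := by
      rw [mul_right_comm, h2]
    rw [add_mul, h4] at h3
    have h5 : (n : ℤ) * (2 * (d ^ 2 - N * r * (d - r))) ≤ 0 := by linarith
    have h6 : (d : ℤ) ^ 2 - N * r * (d - r) = 1 := by linarith [h.form]
    rw [h6] at h5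
    linarith
  rw [mem_intertwiners] at hT
  have hTs : ∀ μ, P μ * Tᴴ = Tᴴ * Q μ := fun μ => by
    have := congrArg Matrix.conjTranspose (hT μ)
    simpa [hP.herm, hQ.herm] using this.symm
  obtain ⟨c, hc⟩ := h.schur hP (T := Tᴴ * T) fun μ => by
    rw [← Matrix.mul_assoc, hTs, Matrix.mul_assoc, hT, Matrix.mul_assoc]
  have hc0 : 0 ≤ c := by
    have := (Matrix.posSemidef_conjTranspose_mul_self T).diag_nonneg (i := ⟨0, h.d_pos⟩)
    rw [hc] at this
    simpa using this
  have hcne : c ≠ 0 := by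
    rintro rfl
    rw [zero_smul] at hc
    exact hT0 (Matrix.conjTranspose_mul_self_eq_zero.mp hc)
  obtain ⟨s, hs⟩ := Complex.nonneg_iff.mp hc0
  have hcre : c = (c.re : ℂ) := Complex.ext rfl (by simpa using hs.symm)
  have hre : 0 < c.re := lt_of_le_of_ne s fun h0 => hcne (by rw [hcre, ← h0]; rfl)
  refine ⟨((1 / Real.sqrt c.re : ℝ) : ℂ) • T, ?_, fun μ => ?_⟩
  · rw [Matrix.conjTranspose_smul, Matrix.smul_mul, Matrix.mul_smul, hc, smul_smul, smul_smul,
      Complex.star_def, Complex.conj_ofReal, hcre, ← Complex.ofReal_mul, ← Complex.ofReal_mul,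
      Complex.ofReal_re]
    have : 1 / Real.sqrt c.re * (1 / Real.sqrt c.re) * c.re = 1 := by
      rw [div_mul_div_comm, Real.mul_self_sqrt hre.le]
      field_simp
    rw [this, Complex.ofReal_one, one_smul]
  · rw [Matrix.mul_smul, hT, Matrix.smul_mul]

/-- Every projection family with the same weight is a multiple of the rigid one. -/
lemma RigidParams.exists_decomposition (h : RigidParams N d r x)
    {P : Fin N → Matrix (Fin d) (Fin d) ℂ} (hP : IsProjFamily x P) :
    ∀ (n : ℕ) (Q : Fin N → Matrix (Fin n) (Fin n) ℂ), IsProjFamily x Q →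
    ∃ (q : ℕ) (T : Fin q → Matrix (Fin n) (Fin d) ℂ),
      (∀ i j, (T i)ᴴ * T j = if i = j then 1 else 0) ∧ ∑ i, T i * (T i)ᴴ = 1 ∧
      ∀ μ i, Q μ * T i = T i * P μ := by
  intro n
  induction n using Nat.strong_induction_on with
  | _ n ih =>
  intro Q hQ
  rcases Nat.eq_zero_or_pos n with rfl | hn
  · exact ⟨0, fun i => i.elim0, fun i => i.elim0, Subsingleton.elim _ _, fun _ i => i.elim0⟩
  -- Split off one copy of `P`; the orthogonal complement of its image is again invariant and has
  -- dimension `n - d`.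
  obtain ⟨S, hS, hQS⟩ := h.exists_isometric_intertwiner hP hQ hn
  obtain ⟨n', W, hW, hWW, hn'⟩ := exists_isometry_compl S hS
  have hSW : Sᴴ * W = 0 := by
    have h1 : Sᴴ * (W * Wᴴ) * W = 0 := by
      rw [hWW, Matrix.mul_sub, ← Matrix.mul_assoc, hS, Matrix.mul_one, Matrix.one_mul, sub_self,
        Matrix.zero_mul]
    rwa [Matrix.mul_assoc, Matrix.mul_assoc, hW, Matrix.mul_one] at h1
  have hSQ : ∀ μ, Sᴴ * Q μ = P μ * Sᴴ := fun μ => by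
    have := congrArg Matrix.conjTranspose (hQS μ)
    simpa [hP.herm, hQ.herm] using this
  have hinv : ∀ μ, W * (Wᴴ * (Q μ * W)) = Q μ * W := fun μ => by
    rw [← Matrix.mul_assoc, hWW, Matrix.sub_mul, Matrix.one_mul, Matrix.mul_assoc S,
      ← Matrix.mul_assoc Sᴴ, hSQ, Matrix.mul_assoc (P μ), hSW, Matrix.mul_zero, Matrix.mul_zero,
      sub_zero]
  have hrep := isProjFamily_compress (x := x) hW hQ.herm
    (fun μ => by rw [← Matrix.mul_assoc, hQ.idem]) hinv
    (by rw [hQ.sum_eq, Matrix.smul_mul, Matrix.one_mul])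
  have hd := h.d_pos
  obtain ⟨q, T, hT1, hT2, hT3⟩ := ih n' (by omega) _ hrep
  refine ⟨q + 1, Fin.cons S fun i => W * T i, ?_, ?_, ?_⟩
  · intro i j
    refine Fin.cases ?_ (fun i => ?_) i <;> refine Fin.cases ?_ (fun j => ?_) j
    · simpa using hS
    · simp [← Matrix.mul_assoc, hSW, (Fin.succ_ne_zero j).symm]
    · have hWS : Wᴴ * S = 0 := by simpa using congrArg Matrix.conjTranspose hSW
      simp [Matrix.mul_assoc, hWS]
    · have : (T i)ᴴ * Wᴴ * (W * T j) = (T i)ᴴ * T j := by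
        rw [Matrix.mul_assoc, ← Matrix.mul_assoc Wᴴ, hW, Matrix.one_mul]
      simp [this, hT1]
  · rw [Fin.sum_univ_succ]
    have : ∀ i, W * T i * (W * T i)ᴴ = W * (T i * (T i)ᴴ) * Wᴴ := fun i => by
      simp [Matrix.mul_assoc]
    simp only [Fin.cons_zero, Fin.cons_succ, this]
    rw [← Matrix.sum_mul, ← Matrix.mul_sum, hT2, Matrix.mul_one, hWW]
    abel
  · intro μ i
    refine Fin.cases ?_ (fun i => ?_) i
    · simpa using hQS μ
    · have h1 := congrArg (W * ·) (hT3 μ i)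
      simp only [Matrix.mul_assoc] at h1
      simp only [Fin.cons_succ]
      have h2 := congrArg (· * T i) (hinv μ)
      simp only [Matrix.mul_assoc] at h2
      rw [Matrix.mul_assoc W, ← h1, h2]

/-- Generation of `gl_d` does not depend on the choice of the rigid projection family. -/
lemma RigidParams.lieGenerates (h : RigidParams N d r x)
    {P P₀ : Fin N → Matrix (Fin d) (Fin d) ℂ} (hP : IsProjFamily x P) (hP₀ : IsProjFamily x P₀)
    (hL : LieGenerates P₀) : LieGenerates P := by
  -- The intertwiner is square, hence unitary, and conjugation by it preserves products and so
  -- brackets.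
  obtain ⟨U, hU, hUP⟩ := h.exists_isometric_intertwiner hP₀ hP h.d_pos
  have hU' : U * Uᴴ = 1 := mul_eq_one_comm.mp hU
  intro L h1 hPL hbr
  let c : Matrix (Fin d) (Fin d) ℂ →ₗ[ℂ] Matrix (Fin d) (Fin d) ℂ := mulLeftRight U Uᴴ
  have hc : ∀ X, c X = U * X * Uᴴ := fun X => rfl
  have hmul : ∀ X Y, c (X * Y) = c X * c Y := fun X Y => by
    rw [hc, hc, hc]
    have : U * X * Uᴴ * (U * Y * Uᴴ) = U * X * (Uᴴ * U) * Y * Uᴴ := by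
      simp only [Matrix.mul_assoc]
    rw [this, hU, Matrix.mul_one, Matrix.mul_assoc U X Y]
  have htop : L.comap c = ⊤ := by
    refine hL _ ?_ ?_ ?_
    · rwa [Submodule.mem_comap, hc, Matrix.mul_one, hU']
    · intro μ
      rw [Submodule.mem_comap, hc, ← hUP, Matrix.mul_assoc, hU', Matrix.mul_one]
      exact hPL μ
    · intro X hX Y hY
      rw [Submodule.mem_comap, map_sub, hmul, hmul]
      exact hbr _ hX _ hY
  rw [Submodule.eq_top_iff']
  intro X
  have h2 : Uᴴ * X * U ∈ L.comap c := htop ▸ Submodule.mem_top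
  rw [Submodule.mem_comap, hc] at h2
  have h3 : U * (Uᴴ * X * U) * Uᴴ = X := by
    rw [Matrix.mul_assoc Uᴴ, ← Matrix.mul_assoc U, hU', Matrix.one_mul, Matrix.mul_assoc, hU',
      Matrix.mul_one]
  rwa [h3] at h2

end Rigid

/-! ### Realizations in which the number of zeros is fixed. -/

section Counting

variable {n : ℕ}

lemma zeros_update_one {a : Fin n → Fin 2} {k : Fin n} (ha : a k = 0) :
    zeros (Function.update a k 1) + 1 = zeros a := by
  have : (Finset.univ.filter fun l => Function.update a k 1 l = 0) =
      (Finset.univ.filter fun l => a l = 0).erase k := by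
    ext l
    rcases eq_or_ne l k with rfl | h <;> simp_all
  rw [zeros, this, zeros]
  exact Finset.card_erase_add_one (by simp [ha])

end Counting

namespace Realization

variable {N n : ℕ} {m : Fin n → ℕ} (R : Realization N m)

/-- When all parties perform measurement `μ`, the number of outcomes `0` is always `rk μ`. -/
def FixedZeros (rk : Fin N → ℕ) : Prop :=
  ∀ μ a, zeros a ≠ rk μ → R.correlation a (fun _ => μ) = 0

lemma effect_posSemidef (a : Fin n → Fin 2) (μ : Fin n → Fin N) : (R.effect a μ).PosSemidef :=
  tensorMat_posSemidef fun k => R.povm_pos k (μ k) (a k)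

lemma povm_herm (k : Fin n) (μ : Fin N) (a : Fin 2) : (R.povm k μ a)ᴴ = R.povm k μ a :=
  (R.povm_pos k μ a).isHermitian

/-- Outcomes `a` of the measurement `μ`, with `a k = 0` and `r` zeros. -/
def zeroOutcomes (n r : ℕ) (k : Fin n) : Finset (Fin n → Fin 2) :=
  Finset.univ.filter fun a => a k = 0 ∧ zeros a = r

/-- The effect of outcome `a` for all parties but `k`. -/
def coEffect (k : Fin n) (a : Fin n → Fin 2) (μ : Fin N) :
    Matrix (∀ k, Fin (m k)) (∀ k, Fin (m k)) ℂ :=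
  tensorMat (Function.update (fun l => R.povm l μ (a l)) k 1)

lemma site_mul_coEffect (k : Fin n) (X : Matrix (Fin (m k)) (Fin (m k)) ℂ) (a : Fin n → Fin 2)
    (μ : Fin N) : site (ι := fun k => Fin (m k)) k X * R.coEffect k a μ =
      tensorMat (Function.update (fun l => R.povm l μ (a l)) k X) := by
  rw [coEffect, site_mul_tensorMat, Function.update_idem, Function.update_self, mul_one]

lemma coEffect_mul_site (k : Fin n) (X : Matrix (Fin (m k)) (Fin (m k)) ℂ) (a : Fin n → Fin 2)
    (μ : Fin N) : R.coEffect k a μ * site (ι := fun k => Fin (m k)) k X =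
      site (ι := fun k => Fin (m k)) k X * R.coEffect k a μ := by
  rw [site_mul_coEffect, coEffect, tensorMat_mul_site, Function.update_idem, Function.update_self,
    one_mul]

lemma site_povm_mul_coEffect (k : Fin n) {a : Fin n → Fin 2} (ha : a k = 0) (μ ν : Fin N) :
    site (ι := fun k => Fin (m k)) k (R.povm k μ 0) * R.coEffect k a ν =
      R.effect a (Function.update (fun _ => ν) k μ) := by
  rw [site_mul_coEffect, effect]
  congr 1
  ext1 l
  rcases eq_or_ne l k with rfl | h
  · simp [ha]
  · simp [Function.update_of_ne h]

lemma site_povm_eq_sum (k : Fin n) (μ : Fin N) :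
    site (ι := fun k => Fin (m k)) k (R.povm k μ 0) =
      ∑ a ∈ Finset.univ.filter (fun a : Fin n → Fin 2 => a k = 0), R.effect a fun _ => μ := by
  -- Replacing the effect of outcome `1` at party `k` by zero turns the sum restricted to `a k = 0`
  -- into an unrestricted one, which factorizes.
  have h := sum_tensorMat (ι := fun k => Fin (m k)) (κ := fun k => Fin (m k)) (α := Fin 2)
    (fun l b => if l = k ∧ b ≠ 0 then 0 else R.povm l μ b)
  have h1 : (fun l => ∑ b : Fin 2, if l = k ∧ b ≠ 0 then 0 else R.povm l μ b) =
      Function.update (fun _ => 1) k (R.povm k μ 0) := by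
    ext1 l
    rcases eq_or_ne l k with rfl | hl
    · simp
    · simp [hl, Fin.sum_univ_two, R.povm_sum]
  rw [h1] at h
  rw [site, ← h, Finset.sum_filter]
  refine Finset.sum_congr rfl fun a _ => ?_
  split_ifs with ha
  · rw [effect]
    congr 1
    ext1 l
    rw [if_neg]
    rintro ⟨rfl, hl⟩
    exact hl ha
  · ext i j
    rw [tensorMat_apply]
    exact Finset.prod_eq_zero (Finset.mem_univ k) (by simp [ha])

variable {R} {rk : Fin N → ℕ}

lemma FixedZeros.effect_mulVec (h : R.FixedZeros rk) {μ : Fin N} {a : Fin n → Fin 2}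
    (ha : zeros a ≠ rk μ) : R.effect a (fun _ => μ) *ᵥ R.state = 0 :=
  ((R.effect_posSemidef a _).dotProduct_mulVec_zero_iff _).mp (h μ a ha)

/-- Changing the outcome of party `k` to `1` leaves one zero too few, which has probability zero. So
the other parties' outcomes already force `a k = 0`. -/
lemma FixedZeros.coEffect_mulVec (h : R.FixedZeros rk) {k : Fin n} {μ : Fin N} {a : Fin n → Fin 2}
    (ha : a ∈ zeroOutcomes n (rk μ) k) :
    R.coEffect k a μ *ᵥ R.state = R.effect a (fun _ => μ) *ᵥ R.state := by
  obtain ⟨ha0, har⟩ := (Finset.mem_filter.mp ha).2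
  rw [coEffect, ← R.povm_sum k μ, tensorMat_update_add, Matrix.add_mulVec]
  have h0 : Function.update (fun l => R.povm l μ (a l)) k (R.povm k μ 0) =
      fun l => R.povm l μ (a l) := by
    rw [← ha0]
    exact Function.update_eq_self (f := fun l => R.povm l μ (a l)) k
  have h1 : Function.update (fun l => R.povm l μ (a l)) k (R.povm k μ 1) =
      fun l => R.povm l μ (Function.update a k 1 l) := by
    ext1 l
    rcases eq_or_ne l k with rfl | hl
    · simp
    · simp [Function.update_of_ne hl]
  have h2 : R.effect (Function.update a k 1) (fun _ => μ) *ᵥ R.state = 0 := by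
    refine h.effect_mulVec ?_
    have := zeros_update_one ha0
    omega
  rw [h0, h1]
  exact (congrArg (_ + ·) h2).trans (add_zero _)

lemma FixedZeros.site_povm_mulVec (h : R.FixedZeros rk) (k : Fin n) (μ : Fin N) :
    site (ι := fun k => Fin (m k)) k (R.povm k μ 0) *ᵥ R.state =
      ∑ a ∈ zeroOutcomes n (rk μ) k, R.effect a (fun _ => μ) *ᵥ R.state := by
  rw [site_povm_eq_sum, Matrix.sum_mulVec]
  symm
  refine Finset.sum_subset (fun a ha => ?_) fun a ha ha' => h.effect_mulVec ?_
  · simp only [zeroOutcomes, Finset.mem_filter] at ha ⊢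
    tauto
  · simp only [zeroOutcomes, Finset.mem_filter] at ha ha'
    tauto

/-- On the state, the effect of party `k` can be replaced by an operator of the other parties. -/
lemma FixedZeros.site_povm_mulVec' (h : R.FixedZeros rk) (k : Fin n) (μ : Fin N) :
    site (ι := fun k => Fin (m k)) k (R.povm k μ 0) *ᵥ R.state =
      (∑ a ∈ zeroOutcomes n (rk μ) k, R.coEffect k a μ) *ᵥ R.state := by
  rw [h.site_povm_mulVec, Matrix.sum_mulVec]
  exact Finset.sum_congr rfl fun a ha => (h.coEffect_mulVec ha).symm

/-- The traded operator acts on the other parties and commutes with `X`. In particular, if `X` kills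
the state at party `k`, so does `X` times the effect; this yields invariance of the local support.
-/
lemma FixedZeros.site_mul_povm_mulVec (h : R.FixedZeros rk) (k : Fin n) (μ : Fin N)
    (X : Matrix (Fin (m k)) (Fin (m k)) ℂ) :
    site (ι := fun k => Fin (m k)) k (X * R.povm k μ 0) *ᵥ R.state =
      (∑ a ∈ zeroOutcomes n (rk μ) k, R.coEffect k a μ) *ᵥ
        (site (ι := fun k => Fin (m k)) k X *ᵥ R.state) := by
  rw [← site_mul, ← Matrix.mulVec_mulVec, h.site_povm_mulVec', Matrix.mulVec_mulVec,
    Matrix.mulVec_mulVec, Finset.mul_sum, Finset.sum_mul]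
  congr 1
  exact Finset.sum_congr rfl fun a _ => (R.coEffect_mul_site k X a μ).symm

/-- Effects are not assumed projective. After trading one of the two factors, the remaining one
completes each `coEffect` to a full effect, which recovers the action of a single factor. -/
lemma FixedZeros.site_povm_sq (h : R.FixedZeros rk) (k : Fin n) (μ : Fin N) :
    site (ι := fun k => Fin (m k)) k (R.povm k μ 0 * R.povm k μ 0 - R.povm k μ 0) *ᵥ R.state =
      0 := by
  rw [site_sub, Matrix.sub_mulVec, sub_eq_zero, ← site_mul, ← Matrix.mulVec_mulVec,
    h.site_povm_mulVec', Matrix.mulVec_mulVec, Finset.mul_sum,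
    Finset.sum_congr rfl fun a ha =>
      R.site_povm_mul_coEffect k (Finset.mem_filter.mp ha).2.1 μ μ,
    Matrix.sum_mulVec, Matrix.sum_mulVec]
  refine Finset.sum_congr rfl fun a ha => ?_
  rw [h.coEffect_mulVec ha, Function.update_eq_self (f := fun _ : Fin n => μ) k]

/-- The vector measuring the failure of `∑ μ, E μ = x` for party `k`. -/
def sumDefect (R : Realization N m) (x : ℚ) (k : Fin n) : (∀ k, Fin (m k)) → ℂ :=
  site (ι := fun k => Fin (m k)) k (∑ μ, R.povm k μ 0 - (x : ℂ) • 1) *ᵥ R.state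

/-- One of the two defect operators is traded to the other parties, which leaves only correlations
of settings where party `k` deviates from a common measurement. Equal correlations therefore give
equal defect norms. -/
lemma FixedZeros.star_sumDefect (h : R.FixedZeros rk) (x : ℚ) (k : Fin n) :
    star (R.sumDefect x k) ⬝ᵥ R.sumDefect x k =
      ∑ ν, ∑ a ∈ zeroOutcomes n (rk ν) k,
        (∑ μ, R.correlation a (Function.update (fun _ => ν) k μ) -
          (x : ℂ) * R.correlation a (fun _ => ν)) -
      (x : ℂ) * (∑ ν, ∑ a ∈ zeroOutcomes n (rk ν) k, R.correlation a (fun _ => ν) - (x : ℂ)) := by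
  set A := ∑ μ, R.povm k μ 0 - (x : ℂ) • 1 with hA
  have hsd : R.sumDefect x k = site (ι := fun k => Fin (m k)) k A *ᵥ R.state := rfl
  clear_value A
  have hAh : Aᴴ = A := by
    rw [hA, Matrix.conjTranspose_sub, Matrix.conjTranspose_sum, Matrix.conjTranspose_smul,
      Matrix.conjTranspose_one]
    simp only [povm_herm]
    rw [Complex.star_def, map_ratCast]
  have h1 : star (R.sumDefect x k) ⬝ᵥ R.sumDefect x k =
      star R.state ⬝ᵥ (site (ι := fun k => Fin (m k)) k A *ᵥ R.sumDefect x k) := by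
    rw [hsd, Matrix.star_mulVec, ← Matrix.dotProduct_mulVec, site_conjTranspose, hAh]
  have h2 : R.sumDefect x k = ∑ ν, ∑ a ∈ zeroOutcomes n (rk ν) k, R.coEffect k a ν *ᵥ R.state -
      (x : ℂ) • R.state := by
    rw [hsd, hA, site_sub, site_sum, site_smul, site_one, Matrix.sub_mulVec, Matrix.sum_mulVec,
      Matrix.smul_mulVec, Matrix.one_mulVec]
    congr 1
    refine Finset.sum_congr rfl fun ν _ => ?_
    rw [h.site_povm_mulVec', Matrix.sum_mulVec]
  have h3 : ∀ ν, ∀ a ∈ zeroOutcomes n (rk ν) k,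
      star R.state ⬝ᵥ (site (ι := fun k => Fin (m k)) k A *ᵥ (R.coEffect k a ν *ᵥ R.state)) =
      ∑ μ, R.correlation a (Function.update (fun _ => ν) k μ) -
          (x : ℂ) * R.correlation a (fun _ => ν) := by
    intro ν a ha
    rw [hA, site_sub, site_sum, site_smul, site_one, Matrix.sub_mulVec, Matrix.sum_mulVec,
      Matrix.smul_mulVec, Matrix.one_mulVec, dotProduct_sub, dotProduct_sum, dotProduct_smul,
      smul_eq_mul]
    refine congrArg₂ (· - ·) (Finset.sum_congr rfl fun μ _ => ?_) ?_
    · rw [Matrix.mulVec_mulVec, R.site_povm_mul_coEffect k (Finset.mem_filter.mp ha).2.1,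
        correlation]
    · rw [h.coEffect_mulVec ha, correlation]
  have h4 : star R.state ⬝ᵥ (site (ι := fun k => Fin (m k)) k A *ᵥ R.state) =
      ∑ ν, ∑ a ∈ zeroOutcomes n (rk ν) k, R.correlation a (fun _ => ν) - (x : ℂ) := by
    rw [← hsd, h2, dotProduct_sub, dotProduct_smul, R.state_unit, dotProduct_sum, smul_eq_mul,
      mul_one]
    refine congrArg₂ (· - ·) (Finset.sum_congr rfl fun ν _ => ?_) rfl
    rw [dotProduct_sum]
    refine Finset.sum_congr rfl fun a ha => ?_
    rw [h.coEffect_mulVec ha, correlation]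
  rw [h1, h2, Matrix.mulVec_sub, Matrix.mulVec_smul, dotProduct_sub, dotProduct_smul, h4,
    smul_eq_mul]
  refine congrArg₂ (· - ·) ?_ rfl
  rw [Matrix.mulVec_sum, dotProduct_sum]
  refine Finset.sum_congr rfl fun ν _ => ?_
  rw [Matrix.mulVec_sum, dotProduct_sum]
  exact Finset.sum_congr rfl fun a ha => h3 ν a ha

/-- The range of `W` is the support of the reduced state of party `k`; a local operator is
determined there by its action on the global state. -/
lemma exists_local_support (R : Realization N m) (k : Fin n) :
    ∃ (s : ℕ) (W : Matrix (Fin (m k)) (Fin s) ℂ), Wᴴ * W = 1 ∧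
      site (ι := fun k => Fin (m k)) k (W * Wᴴ) *ᵥ R.state = R.state ∧
      ∀ X, site (ι := fun k => Fin (m k)) k X *ᵥ R.state = 0 → X * W = 0 := by
  -- The columns are indexed by full multi-indices, whose entry at `k` is overwritten. The repeated
  -- columns do not change the column space.
  obtain ⟨s, W, h1, h2, h3⟩ := exists_isometry_of_matrix
    (Matrix.of fun (j : Fin (m k)) (i : ∀ k, Fin (m k)) => R.state (Function.update i k j))
  refine ⟨s, W, h1, ?_, fun X hX => h3 X ?_⟩
  · ext i
    rw [site_mulVec_apply]
    have := congrFun (congrFun h2 (i k)) i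
    rw [Matrix.mul_apply] at this
    simpa using this
  · ext j i
    have := congrFun hX (Function.update i k j)
    rw [site_mulVec_apply] at this
    simpa [Matrix.mul_apply] using this

lemma site_fixes_tensorMat {S : ∀ k, Matrix (Fin (m k)) (Fin (m k)) ℂ}
    {v : (∀ k, Fin (m k)) → ℂ} (h : ∀ k, site (ι := fun k => Fin (m k)) k (S k) *ᵥ v = v) :
    tensorMat S *ᵥ v = v := by
  have hs : ∀ s : Finset (Fin n), tensorMat (fun k => if k ∈ s then S k else 1) *ᵥ v = v := by
    intro s
    induction s using Finset.induction_on with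
    | empty => simp [tensorMat_one (ι := fun k => Fin (m k))]
    | insert k s hk ih =>
      have h1 : (fun l => if l ∈ insert k s then S l else 1) =
          Function.update (fun l => if l ∈ s then S l else 1) k
            (S k * (if k ∈ s then S k else 1)) := by
        ext1 l
        rcases eq_or_ne l k with rfl | hl
        · simp [hk]
        · simp [hl]
      rw [h1, ← site_mul_tensorMat k (S k) (fun l => if l ∈ s then S l else 1),
        ← Matrix.mulVec_mulVec, ih, h]
  simpa using hs Finset.univ

end Realization

/-! ### Slicing a state along the junk factors. -/

section Junk

variable {n : ℕ} {ι κ : Fin n → Type} [∀ k, Fintype (ι k)] [∀ k, Fintype (κ k)]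
  [∀ k, DecidableEq (κ k)]

set_option linter.unusedSectionVars false

/-- The component of `ξ ∈ ⊗ₖ (ℂ^(ι k) ⊗ ℂ^(κ k))` at the junk basis vector `j`. -/
def junkSlice (ξ : (∀ k, ι k × κ k) → ℂ) (j : ∀ k, κ k) : (∀ k, ι k) → ℂ :=
  fun i => ξ fun k => (i k, j k)

lemma junkSlice_kronecker_mulVec (A : ∀ k, Matrix (ι k) (ι k) ℂ) (ξ : (∀ k, ι k × κ k) → ℂ)
    (j : ∀ k, κ k) : junkSlice (tensorMat (fun k => A k ⊗ₖ (1 : Matrix (κ k) (κ k) ℂ)) *ᵥ ξ) j =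
      tensorMat A *ᵥ junkSlice ξ j := by
  classical
  ext i
  simp only [junkSlice, Matrix.mulVec, dotProduct]
  rw [← Equiv.sum_comp (Equiv.arrowProdEquivProdArrow (Fin n) ι κ).symm, Fintype.sum_prod_type]
  refine Finset.sum_congr rfl fun i' _ => ?_
  rw [Finset.sum_eq_single j]
  · congr 1
    simp [tensorMat_apply, Equiv.arrowProdEquivProdArrow]
  · intro j' _ hj
    obtain ⟨k, hk⟩ := Function.ne_iff.mp hj
    rw [tensorMat_apply, Finset.prod_eq_zero (Finset.mem_univ k), zero_mul]
    simp [Equiv.arrowProdEquivProdArrow, Matrix.one_apply_ne hk.symm]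
  · simp

lemma ext_junkSlice {ξ η : (∀ k, ι k × κ k) → ℂ} (h : ∀ j, junkSlice ξ j = junkSlice η j) :
    ξ = η := by
  ext p
  exact congrFun (h fun k => (p k).2) fun k => (p k).1

lemma junkSlice_tensorVec (φ : (∀ k, ι k) → ℂ) (χ : (∀ k, κ k) → ℂ) (j : ∀ k, κ k) :
    junkSlice (tensorVec φ χ) j = χ j • φ := by
  ext i
  exact mul_comm _ _

lemma kronecker_mulVec_tensorVec (A : ∀ k, Matrix (ι k) (ι k) ℂ) (φ : (∀ k, ι k) → ℂ)
    (χ : (∀ k, κ k) → ℂ) :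
    tensorMat (fun k => A k ⊗ₖ (1 : Matrix (κ k) (κ k) ℂ)) *ᵥ tensorVec φ χ =
      tensorVec (tensorMat A *ᵥ φ) χ := by
  refine ext_junkSlice fun j => ?_
  rw [junkSlice_kronecker_mulVec, junkSlice_tensorVec, junkSlice_tensorVec, Matrix.mulVec_smul]

lemma star_tensorVec_dotProduct (φ : (∀ k, ι k) → ℂ) (χ : (∀ k, κ k) → ℂ) :
    star (tensorVec φ χ) ⬝ᵥ tensorVec φ χ = (star φ ⬝ᵥ φ) * (star χ ⬝ᵥ χ) := by
  classical
  simp only [dotProduct]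
  rw [← Equiv.sum_comp (Equiv.arrowProdEquivProdArrow (Fin n) ι κ).symm, Fintype.sum_prod_type,
    Finset.sum_mul_sum]
  refine Finset.sum_congr rfl fun i _ => Finset.sum_congr rfl fun j _ => ?_
  simp only [Pi.star_apply, tensorVec, Equiv.arrowProdEquivProdArrow, Equiv.coe_fn_symm_mk,
    star_mul']
  ring

end Junk

/-! ### Local isometries assembled from blocks. -/

section Blocks

variable {d m q : ℕ}

/-- The matrix `ℂ^m → ℂ^d ⊗ ℂ^q` with blocks `B j : ℂ^m → ℂ^d`. -/
def ofBlocks (B : Fin q → Matrix (Fin d) (Fin m) ℂ) : Matrix (Fin d × Fin q) (Fin m) ℂ :=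
  Matrix.of fun p b => B p.2 p.1 b

lemma ofBlocks_conjTranspose_mul_self (B : Fin q → Matrix (Fin d) (Fin m) ℂ) :
    (ofBlocks B)ᴴ * ofBlocks B = ∑ j, (B j)ᴴ * B j := by
  ext a b
  simp only [Matrix.mul_apply, Matrix.sum_apply, Fintype.sum_prod_type_right]
  rfl

lemma ofBlocks_mul (B : Fin q → Matrix (Fin d) (Fin m) ℂ) (X : Matrix (Fin m) (Fin m) ℂ) :
    ofBlocks B * X = ofBlocks fun j => B j * X := by
  ext p b
  simp only [Matrix.mul_apply, ofBlocks, Matrix.of_apply]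

lemma kronecker_mul_ofBlocks (B : Fin q → Matrix (Fin d) (Fin m) ℂ)
    (A : Matrix (Fin d) (Fin d) ℂ) :
    (A ⊗ₖ (1 : Matrix (Fin q) (Fin q) ℂ)) * ofBlocks B = ofBlocks fun j => A * B j := by
  ext p b
  simp only [Matrix.mul_apply, ofBlocks, Matrix.of_apply, Fintype.sum_prod_type,
    Matrix.kroneckerMap_apply, Matrix.one_apply]
  simp

/-- A reducing isometry `W`, on whose range `E` is a multiple of `P`, extends to an isometry into
`ℂ^d ⊗ ℂ^(q + m)` carrying `E` to `P ⊗ 1` on the range of `W`. -/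
lemma exists_isometry_kronecker {N s : ℕ} (hd : 0 < d)
    {W : Matrix (Fin m) (Fin s) ℂ} (hW : Wᴴ * W = 1) {E : Fin N → Matrix (Fin m) (Fin m) ℂ}
    (hinv : ∀ μ, W * (Wᴴ * (E μ * W)) = E μ * W) {P : Fin N → Matrix (Fin d) (Fin d) ℂ}
    (hPh : ∀ μ, (P μ)ᴴ = P μ) (hEh : ∀ μ, (E μ)ᴴ = E μ)
    {T : Fin q → Matrix (Fin s) (Fin d) ℂ}
    (hT : ∑ i, T i * (T i)ᴴ = 1) (hPT : ∀ μ i, Wᴴ * (E μ * W) * T i = T i * P μ) :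
    ∃ V : Matrix (Fin d × Fin (q + m)) (Fin m) ℂ, Vᴴ * V = 1 ∧
      ∀ μ, V * (E μ * (W * Wᴴ)) =
        (P μ ⊗ₖ (1 : Matrix (Fin (q + m)) (Fin (q + m)) ℂ)) * (V * (W * Wᴴ)) := by
  set e : Fin d := ⟨0, hd⟩
  -- Filler blocks: the part of a vector orthogonal to the range of `W` is stored in the last `m`
  -- junk coordinates, next to a fixed basis vector of `ℂ^d`. This makes `V` isometric everywhere
  -- without affecting the range of `W`.
  set C : Fin m → Matrix (Fin d) (Fin m) ℂ := fun b =>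
    Matrix.of fun i c => if i = e then (1 - W * Wᴴ : Matrix (Fin m) (Fin m) ℂ) b c else 0 with hC
  have hCmul : ∀ b (X : Matrix (Fin m) (Fin m) ℂ), (1 - W * Wᴴ) * X = 0 → C b * X = 0 := by
    intro b X hX
    ext i c
    have h1 := congrFun (congrFun hX b) c
    rw [Matrix.mul_apply] at h1 ⊢
    by_cases hi : i = e
    · simpa [hC, hi] using h1
    · simp [hC, hi]
  have h0 : (1 - W * Wᴴ) * W = 0 := by
    rw [Matrix.sub_mul, Matrix.mul_assoc, hW, Matrix.one_mul, Matrix.mul_one, sub_self]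
  refine ⟨ofBlocks (Fin.append (fun i => (T i)ᴴ * Wᴴ) C), ?_, fun μ => ?_⟩
  · rw [ofBlocks_conjTranspose_mul_self, Fin.sum_univ_add]
    simp only [Fin.append_left, Fin.append_right]
    have h1 : ∑ i, ((T i)ᴴ * Wᴴ)ᴴ * ((T i)ᴴ * Wᴴ) = W * Wᴴ := by
      have : ∀ i, ((T i)ᴴ * Wᴴ)ᴴ * ((T i)ᴴ * Wᴴ) = W * (T i * (T i)ᴴ) * Wᴴ := fun i => by
        simp [Matrix.mul_assoc]
      simp only [this]
      rw [← Matrix.sum_mul, ← Matrix.mul_sum, hT, Matrix.mul_one]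
    have h2 : ∑ b, (C b)ᴴ * C b = (1 - W * Wᴴ)ᴴ * (1 - W * Wᴴ) := by
      ext i j
      rw [Matrix.sum_apply, Matrix.mul_apply]
      refine Finset.sum_congr rfl fun b _ => ?_
      simp [Matrix.mul_apply, hC, Matrix.conjTranspose_apply]
    have h3 : (1 - W * Wᴴ)ᴴ * (1 - W * Wᴴ) = 1 - W * Wᴴ := by
      rw [Matrix.conjTranspose_sub, Matrix.conjTranspose_mul, Matrix.conjTranspose_one,
        Matrix.conjTranspose_conjTranspose, Matrix.mul_sub, ← Matrix.mul_assoc, h0,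
        Matrix.zero_mul, sub_zero, Matrix.mul_one]
    rw [h1, h2, h3]
    abel
  · rw [ofBlocks_mul, ofBlocks_mul, kronecker_mul_ofBlocks]
    congr 1
    ext1 j
    refine Fin.addCases (fun i => ?_) (fun b => ?_) j
    · simp only [Fin.append_left]
      have h1 := congrArg Matrix.conjTranspose (hPT μ i)
      simp only [Matrix.conjTranspose_mul, Matrix.conjTranspose_conjTranspose, hPh, hEh] at h1
      have h2 : (T i)ᴴ * Wᴴ * (E μ * (W * Wᴴ)) = (T i)ᴴ * (Wᴴ * E μ * W) * Wᴴ := by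
        simp only [Matrix.mul_assoc]
      rw [h2, h1]
      have h3 : (T i)ᴴ * Wᴴ * (W * Wᴴ) = (T i)ᴴ * (Wᴴ * W) * Wᴴ := by
        simp only [Matrix.mul_assoc]
      rw [h3, hW, Matrix.mul_one, Matrix.mul_assoc]
    · simp only [Fin.append_right]
      rw [hCmul b, hCmul b, Matrix.mul_zero]
      · rw [← Matrix.mul_assoc, h0, Matrix.zero_mul]
      · rw [← Matrix.mul_assoc (E μ), ← hinv, ← Matrix.mul_assoc, ← Matrix.mul_assoc, h0,
          Matrix.zero_mul, Matrix.zero_mul]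

end Blocks

/-! ### Self-testing from rigidity and uniqueness of the Slater state. -/

section SelfTest

variable {N d r : ℕ} {x : ℚ} {P : Fin N → Matrix (Fin d) (Fin d) ℂ}

lemma canonical_effect (hP : IsProjFamily x P) (a : Fin d → Fin 2) (μ : Fin N) :
    (canonical hP).effect a (fun _ => μ) = outcomeMat (P μ) a := rfl

lemma canonical_fixedZeros (hP : IsProjFamily x P) :
    (canonical hP).FixedZeros fun μ => (P μ).rank := by
  intro μ a ha
  rw [Realization.correlation, canonical_effect]
  have : outcomeMat (P μ) a *ᵥ (canonical hP).state = 0 := outcomeMat_slater (hP.idem μ) ha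
  rw [this, dotProduct_zero]

lemma canonical_sumDefect (hP : IsProjFamily x P) (k : Fin d) :
    (canonical hP).sumDefect x k = 0 := by
  have h : ∑ μ, (canonical hP).povm k μ 0 - (x : ℂ) • 1 = 0 := by
    rw [sub_eq_zero, ← hP.sum_eq]
    rfl
  rw [Realization.sumDefect, h,
    ← zero_smul ℂ (0 : Matrix (Fin d) (Fin d) ℂ), site_smul (ι := fun _ : Fin d => Fin d)]
  simp

/-- Compressed to the local support, the effects form a projection family of weight `x`, hence a
multiple of `P`. Here `S` is the projection onto that support. -/
lemma RigidParams.exists_local_isometry (h : RigidParams N d r x) (hP : IsProjFamily x P)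
    {m : Fin d → ℕ} {R : Realization N m} {rk : Fin N → ℕ} (hR : R.FixedZeros rk)
    (hx : ∀ k, R.sumDefect x k = 0) (k : Fin d) :
    ∃ (q : ℕ) (V : Matrix (Fin d × Fin q) (Fin (m k)) ℂ) (S : Matrix (Fin (m k)) (Fin (m k)) ℂ),
      Vᴴ * V = 1 ∧ site (ι := fun k => Fin (m k)) k S *ᵥ R.state = R.state ∧
      ∀ μ a, V * (R.povm k μ a * S) =
        ((canonical hP).povm k μ a ⊗ₖ (1 : Matrix (Fin q) (Fin q) ℂ)) * (V * S) := by
  obtain ⟨s, W, h1, h2, h3⟩ := R.exists_local_support k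
  have hherm : ∀ μ, (R.povm k μ 0)ᴴ = R.povm k μ 0 := fun μ => R.povm_herm k μ 0
  have hidem : ∀ μ, R.povm k μ 0 * (R.povm k μ 0 * W) = R.povm k μ 0 * W := fun μ => by
    have := h3 _ (hR.site_povm_sq k μ)
    rwa [Matrix.sub_mul, sub_eq_zero, Matrix.mul_assoc] at this
  have hinv : ∀ μ, W * (Wᴴ * (R.povm k μ 0 * W)) = R.povm k μ 0 * W := fun μ => by
    have h4 : site (ι := fun k => Fin (m k)) k ((W * Wᴴ - 1) * R.povm k μ 0) *ᵥ R.state = 0 := by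
      rw [hR.site_mul_povm_mulVec, site_sub, Matrix.sub_mulVec, h2, site_one, Matrix.one_mulVec,
        sub_self, Matrix.mulVec_zero]
    have := h3 _ h4
    rwa [Matrix.mul_assoc, Matrix.sub_mul, Matrix.one_mul, sub_eq_zero, Matrix.mul_assoc] at this
  have hsum : (∑ μ, R.povm k μ 0) * W = (x : ℂ) • W := by
    have := h3 _ (hx k)
    rwa [Matrix.sub_mul, sub_eq_zero, Matrix.smul_mul, Matrix.one_mul] at this
  have hrep := isProjFamily_compress h1 hherm hidem hinv hsum
  obtain ⟨q, T, -, hT, hPT⟩ := h.exists_decomposition hP _ _ hrep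
  obtain ⟨V, hV, hVE⟩ := exists_isometry_kronecker h.d_pos h1 hinv hP.herm hherm hT hPT
  refine ⟨_, V, W * Wᴴ, hV, h2, fun μ a => ?_⟩
  have h0 : (canonical hP).povm k μ 0 = P μ := rfl
  have h1' : (canonical hP).povm k μ 1 = 1 - P μ := rfl
  have hE1 : R.povm k μ 1 = 1 - R.povm k μ 0 := eq_sub_of_add_eq' (R.povm_sum k μ)
  fin_cases a
  · exact hVE μ
  · change V * (R.povm k μ 1 * (W * Wᴴ)) =
      ((1 - P μ) ⊗ₖ (1 : Matrix (Fin (q + m k)) (Fin (q + m k)) ℂ)) * (V * (W * Wᴴ))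
    have hsub : (1 - P μ) ⊗ₖ (1 : Matrix (Fin (q + m k)) (Fin (q + m k)) ℂ) =
        1 - P μ ⊗ₖ (1 : Matrix (Fin (q + m k)) (Fin (q + m k)) ℂ) := by
      rw [eq_sub_iff_add_eq, ← Matrix.add_kronecker, sub_add_cancel, Matrix.one_kronecker_one]
    rw [hE1, Matrix.sub_mul, Matrix.mul_sub, hVE, hsub, Matrix.sub_mul, Matrix.one_mul,
      Matrix.one_mul]

/-- The local isometries turn the effects into those of `P` tensored with the identity. Each junk
slice of the image then inherits the fixed number of zeros for every `μ`, which places it in the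
range of `S_μ`. -/
theorem RigidParams.selfTests (h : RigidParams N d r x) (hP : IsProjFamily x P)
    (hu : SlaterUnique P) : (canonical hP).SelfTests := by
  intro m R hcorr
  have hR : R.FixedZeros fun μ => (P μ).rank := fun μ a ha => by
    rw [hcorr, canonical_fixedZeros hP μ a ha]
  -- The norm of the defect is the same for the reference strategy, where the defect vanishes.
  have hx : ∀ k, R.sumDefect x k = 0 := fun k => by
    rw [← dotProduct_star_self_eq_zero, hR.star_sumDefect]
    simp only [hcorr]
    rw [← (canonical_fixedZeros hP).star_sumDefect, canonical_sumDefect, dotProduct_zero]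
  choose q V S hV hS hVS using fun k => h.exists_local_isometry hP hR hx k
  have hψ : tensorMat S *ᵥ R.state = R.state := Realization.site_fixes_tensorMat hS
  set ξ := tensorMat V *ᵥ R.state with hξ
  have heff : ∀ a μ, tensorMat V *ᵥ (R.effect a μ *ᵥ R.state) =
      tensorMat (fun k => (canonical hP).povm k (μ k) (a k) ⊗ₖ
        (1 : Matrix (Fin (q k)) (Fin (q k)) ℂ)) *ᵥ ξ := by
    intro a μ
    rw [hξ, ← hψ, Realization.effect]
    simp only [tensorMat_mul_mulVec, hVS]
  have hslice : ∀ j, ∃ c : ℂ, junkSlice ξ j = c • slater d := by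
    intro j
    refine hu _ fun μ => mem_range_symProj fun a ha => ?_
    have h1 := heff a fun _ => μ
    rw [hR.effect_mulVec ha, Matrix.mulVec_zero] at h1
    have h2 := junkSlice_kronecker_mulVec (fun k => (canonical hP).povm k μ (a k)) ξ j
    rw [← h1] at h2
    exact h2.symm
  choose χ hχ using hslice
  have hξχ : ξ = tensorVec (slater d) χ :=
    ext_junkSlice fun j => by rw [hχ, junkSlice_tensorVec]
  refine ⟨q, V, χ, hV, ?_, hξχ, fun a μ => ?_⟩
  · have h1 : star ξ ⬝ᵥ ξ = 1 := by
      rw [hξ, Matrix.star_mulVec, ← Matrix.dotProduct_mulVec, Matrix.mulVec_mulVec,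
        tensorMat_conjTranspose, tensorMat_mul]
      simp only [hV]
      rw [tensorMat_one (ι := fun k => Fin (m k)), Matrix.one_mulVec, R.state_unit]
    rw [hξχ, star_tensorVec_dotProduct, slater_unit, one_mul] at h1
    exact h1
  · rw [heff, hξχ]
    exact kronecker_mulVec_tensorVec _ _ _

end SelfTest

/-! ### Generation of `gl_d` by the projections of a regular simplex. -/

section Simplex

variable {N d : ℕ}

lemma vecMulVec_mul_vecMulVec' (u v w z : Fin d → ℂ) :
    Matrix.vecMulVec u v * Matrix.vecMulVec w z = (v ⬝ᵥ w) • Matrix.vecMulVec u z := by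
  ext i j
  simp only [Matrix.mul_apply, Matrix.vecMulVec_apply, Matrix.smul_apply, smul_eq_mul, dotProduct,
    Finset.sum_mul]
  exact Finset.sum_congr rfl fun k _ => by ring

/-- Pairwise non-orthogonal rank-one projections that sum to a nonzero scalar generate `gl_d`. -/
lemma lieGenerates_of_rankOne {x c : ℂ} (hx : x ≠ 0) (hc : c ≠ 0) {u : Fin N → Fin d → ℂ}
    (hu : ∀ μ ν, star (u μ) ⬝ᵥ u ν ≠ 0)
    (hsum : ∑ μ, c • Matrix.vecMulVec (u μ) (star (u μ)) = x • 1) :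
    LieGenerates fun μ => c • Matrix.vecMulVec (u μ) (star (u μ)) := by
  intro L _ hPL hbr
  set E := fun μ ν => Matrix.vecMulVec (u μ) (star (u ν)) with hE
  set g := fun μ ν => star (u μ) ⬝ᵥ u ν with hg
  have hmul : ∀ a b a' b', E a b * E a' b' = g b a' • E a b' := fun a b a' b' =>
    vecMulVec_mul_vecMulVec' _ _ _ _
  have hdiag : ∀ μ, E μ μ ∈ L := fun μ => by
    have := L.smul_mem c⁻¹ (hPL μ)
    rwa [smul_smul, inv_mul_cancel₀ hc, one_smul] at this
  have hoff : ∀ i j, E i j ∈ L := by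
    intro i j
    have h1 := hbr _ (hdiag i) _ (hdiag j)
    have h2 := hbr _ (hdiag i) _ h1
    -- The single bracket contains `g i j • E i j - g j i • E j i`; the double bracket contains `g i
    -- i` times the sum of the same two terms, up to a multiple of `E i i`. Adding them isolates `E
    -- i j`.
    have h3 : (2 * g i i * g i j) • E i j =
        g i i • (E i i * E j j - E j j * E i i) +
          (E i i * (E i i * E j j - E j j * E i i) - (E i i * E j j - E j j * E i i) * E i i) +
          (2 * (g i j * g j i)) • E i i := by
      simp only [mul_sub, sub_mul, hmul, smul_sub, smul_smul, mul_smul_comm, smul_mul_assoc]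
      module
    have h4 : (2 * g i i * g i j) • E i j ∈ L := by
      rw [h3]
      exact L.add_mem (L.add_mem (L.smul_mem _ h1) h2) (L.smul_mem _ (hdiag i))
    have hne : 2 * g i i * g i j ≠ 0 := mul_ne_zero (mul_ne_zero two_ne_zero (hu i i)) (hu i j)
    exact (L.smul_mem_iff hne).mp h4
  rw [Submodule.eq_top_iff']
  intro X
  -- Multiplying `X` on both sides by the scalar sum expands it in the `E μ ν`.
  have h1 : (x * x) • X = (∑ μ, c • E μ μ) * X * ∑ ν, c • E ν ν := by
    rw [hsum]
    simp [smul_smul]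
  have h2 : ∀ μ ν, (c • E μ μ) * X * (c • E ν ν) =
      (c * c * (star (u μ) ⬝ᵥ (X *ᵥ u ν))) • E μ ν := by
    intro μ ν
    rw [smul_mul_assoc, smul_mul_assoc, mul_smul_comm, smul_smul, hE]
    simp only
    rw [Matrix.vecMulVec_mul, vecMulVec_mul_vecMulVec', smul_smul, Matrix.dotProduct_mulVec]
  refine (L.smul_mem_iff (mul_ne_zero hx hx)).mp ?_
  rw [h1, Finset.sum_mul, Finset.sum_mul_sum]
  refine L.sum_mem fun μ _ => L.sum_mem fun ν _ => ?_
  rw [h2]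
  exact L.smul_mem _ (hoff μ ν)

/-- A primitive root of unity of order `d + 1`. -/
def simplexRoot (d : ℕ) : ℂ := Complex.exp (2 * Real.pi * Complex.I / ((d + 1 : ℕ) : ℂ))

lemma simplexRoot_primitive (d : ℕ) : IsPrimitiveRoot (simplexRoot d) (d + 1) :=
  Complex.isPrimitiveRoot_exp (d + 1) d.succ_ne_zero

lemma star_simplexRoot (d : ℕ) : star (simplexRoot d) = (simplexRoot d)⁻¹ := by
  have := Complex.norm_eq_one_of_pow_eq_one (simplexRoot_primitive d).pow_eq_one d.succ_ne_zero
  exact (Complex.inv_eq_conj this).symm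

/-- The vertices of a regular simplex in `ℂ^d`, up to normalization. -/
def simplexVec (d : ℕ) (μ : Fin (d + 1)) : Fin d → ℂ := fun i => simplexRoot d ^ ((μ : ℕ) * i)

/-- The ratio of two powers of the root of unity. -/
lemma simplexRoot_ratio {d a b : ℕ} (ha : a < d + 1) (hb : b < d + 1)
    (h : star (simplexRoot d) ^ a * simplexRoot d ^ b = 1) : a = b := by
  rw [star_simplexRoot, inv_pow, inv_mul_eq_one₀ (pow_ne_zero _
    ((simplexRoot_primitive d).ne_zero d.succ_ne_zero))] at h
  exact (simplexRoot_primitive d).pow_inj ha hb h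

lemma simplexRoot_ratio_pow (d a b : ℕ) :
    (star (simplexRoot d) ^ a * simplexRoot d ^ b) ^ (d + 1) = 1 := by
  have h := (simplexRoot_primitive d).pow_eq_one
  have h' : star (simplexRoot d) ^ (d + 1) = 1 := by
    rw [← star_pow, h, star_one]
  rw [mul_pow, ← pow_mul, ← pow_mul, mul_comm a, mul_comm b, pow_mul, pow_mul, h, h', one_pow,
    one_pow, one_mul]

lemma simplexVec_dotProduct (d : ℕ) (μ ν : Fin (d + 1)) :
    star (simplexVec d μ) ⬝ᵥ simplexVec d ν =
      ∑ i ∈ Finset.range d, (star (simplexRoot d) ^ (μ : ℕ) * simplexRoot d ^ (ν : ℕ)) ^ i := by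
  rw [dotProduct, Finset.sum_range]
  refine Finset.sum_congr rfl fun i _ => ?_
  rw [Pi.star_apply, simplexVec, simplexVec, star_pow, mul_pow, pow_mul, pow_mul]

lemma simplexVec_dotProduct_self (d : ℕ) (μ : Fin (d + 1)) :
    star (simplexVec d μ) ⬝ᵥ simplexVec d μ = d := by
  have h0 : simplexRoot d ≠ 0 := (simplexRoot_primitive d).ne_zero d.succ_ne_zero
  rw [simplexVec_dotProduct, star_simplexRoot, inv_pow, inv_mul_cancel₀ (pow_ne_zero _ h0)]
  simp

/-- A vanishing geometric sum of length `d` would give `η ^ d = 1`; with `η ^ (d + 1) = 1` this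
forces `η = 1`, hence `μ = ν`. -/
lemma simplexVec_dotProduct_ne_zero {d : ℕ} (hd : 1 ≤ d) (μ ν : Fin (d + 1)) :
    star (simplexVec d μ) ⬝ᵥ simplexVec d ν ≠ 0 := by
  by_cases h : μ = ν
  · subst h
    rw [simplexVec_dotProduct_self]
    exact_mod_cast (by omega : d ≠ 0)
  · rw [simplexVec_dotProduct]
    intro h0
    have h1 := simplexRoot_ratio_pow d μ ν
    set η := star (simplexRoot d) ^ (μ : ℕ) * simplexRoot d ^ (ν : ℕ) with hη
    have h2 := geom_sum_mul η d
    rw [h0, zero_mul] at h2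
    rw [pow_succ, sub_eq_zero.mp h2.symm, one_mul] at h1
    exact h (Fin.ext (simplexRoot_ratio μ.2 ν.2 h1))

/-- The projections onto the vertices of a regular simplex in `ℂ^d`. -/
def simplexProj (d : ℕ) (μ : Fin (d + 1)) : Matrix (Fin d) (Fin d) ℂ :=
  (d : ℂ)⁻¹ • Matrix.vecMulVec (simplexVec d μ) (star (simplexVec d μ))

/-- The coordinates form the Fourier matrix of order `d + 1` with one frequency omitted, and the
remaining frequencies stay orthogonal under summation over `μ`. -/
lemma sum_simplexProj (d : ℕ) :
    ∑ μ, simplexProj d μ = (((d : ℂ) + 1) / d) • (1 : Matrix (Fin d) (Fin d) ℂ) := by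
  simp only [simplexProj, ← Finset.smul_sum]
  rw [div_eq_inv_mul, mul_smul]
  congr 1
  ext i j
  rw [Matrix.sum_apply, Matrix.smul_apply, Matrix.one_apply]
  have h1 : ∀ μ : Fin (d + 1), Matrix.vecMulVec (simplexVec d μ) (star (simplexVec d μ)) i j =
      (star (simplexRoot d) ^ (j : ℕ) * simplexRoot d ^ (i : ℕ)) ^ (μ : ℕ) := fun μ => by
    rw [Matrix.vecMulVec_apply, Pi.star_apply, simplexVec, simplexVec, star_pow, mul_pow,
      ← pow_mul, ← pow_mul, mul_comm (μ : ℕ), mul_comm (μ : ℕ), mul_comm]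
  rw [Finset.sum_congr rfl fun μ _ => h1 μ, ← Finset.sum_range
    (fun k => (star (simplexRoot d) ^ (j : ℕ) * simplexRoot d ^ (i : ℕ)) ^ k)]
  split_ifs with hij
  · subst hij
    have h0 : simplexRoot d ≠ 0 := (simplexRoot_primitive d).ne_zero d.succ_ne_zero
    rw [star_simplexRoot, inv_pow, inv_mul_cancel₀ (pow_ne_zero _ h0)]
    simp
  · have h2 := geom_sum_mul (star (simplexRoot d) ^ (j : ℕ) * simplexRoot d ^ (i : ℕ)) (d + 1)
    rw [simplexRoot_ratio_pow, sub_self] at h2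
    rcases mul_eq_zero.mp h2 with h3 | h3
    · rw [h3, smul_zero]
    · have := simplexRoot_ratio (by omega) (by omega) (sub_eq_zero.mp h3)
      exact absurd (Fin.ext this.symm) hij

lemma isProjFamily_simplexProj {d : ℕ} (hd : 1 ≤ d) :
    IsProjFamily (((d : ℚ) + 1) / d) (simplexProj d) where
  isProj μ := by
    have hd0 : (d : ℂ) ≠ 0 := by exact_mod_cast (by omega : d ≠ 0)
    refine ⟨?_, ?_⟩
    · rw [IsIdempotentElem, simplexProj, smul_mul_smul_comm, vecMulVec_mul_vecMulVec',
        simplexVec_dotProduct_self, smul_smul]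
      congr 1
      field_simp
    · rw [IsSelfAdjoint, Matrix.star_eq_conjTranspose, simplexProj, Matrix.conjTranspose_smul,
        Matrix.conjTranspose_vecMulVec]
      simp
  sum_eq := by
    rw [sum_simplexProj]
    push_cast
    rfl

lemma lieGenerates_simplexProj {d : ℕ} (hd : 1 ≤ d) : LieGenerates (simplexProj d) := by
  have hd0 : (d : ℂ) ≠ 0 := by exact_mod_cast (by omega : d ≠ 0)
  have hd1 : (d : ℂ) + 1 ≠ 0 := by exact_mod_cast d.succ_ne_zero
  exact lieGenerates_of_rankOne (div_ne_zero hd1 hd0) (inv_ne_zero hd0)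
    (simplexVec_dotProduct_ne_zero hd) (sum_simplexProj d)

lemma rigidParams_simplex {d : ℕ} (hd : 1 ≤ d) : RigidParams (d + 1) d 1 (((d : ℚ) + 1) / d) where
  d_pos := hd
  x_mul := by
    have : (d : ℚ) ≠ 0 := by exact_mod_cast (by omega : d ≠ 0)
    field_simp
    push_cast
    ring
  form := by
    push_cast
    ring

end Simplex

/-! ### Real roots behind the set `Λ_N`. -/

section LambdaSeq

/-- The new root is `((N - 1) d - N r; d - r)`, the dimension vector obtained by replacing each
projection by its complement and then reflecting at the centre of the star. The form is invariant.
The bound `x ≤ 2` is carried along to keep `N - 1 - x ≥ 1`. -/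
lemma RigidParams.step {N d r : ℕ} {x : ℚ} (hN : 4 ≤ N) (h : RigidParams N d r x) (hx : x ≤ 2) :
    ∃ d' r', RigidParams N d' r' (1 + 1 / ((N : ℚ) - 1 - x)) ∧
      1 + 1 / ((N : ℚ) - 1 - x) ≤ 2 := by
  have hd : (0 : ℚ) < d := by exact_mod_cast h.d_pos
  have hN' : (4 : ℚ) ≤ N := by exact_mod_cast hN
  have hpos : (1 : ℚ) ≤ N - 1 - x := by linarith
  have hne : (N : ℚ) - 1 - x ≠ 0 := by linarith
  have hlt : N * r < (N - 1) * d := by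
    have h1 : (N * r : ℚ) < (N - 1) * d := by
      rw [← h.x_mul]
      exact mul_lt_mul_of_pos_right (by linarith) hd
    have h2 : ((N * r : ℕ) : ℚ) < (((N - 1) * d : ℕ) : ℚ) := by
      rw [Nat.cast_mul, Nat.cast_mul, Nat.cast_sub (by omega)]
      exact_mod_cast h1
    exact_mod_cast h2
  have hle : r ≤ d := by
    by_contra! hcon
    have : (N - 1) * d ≤ N * r := Nat.mul_le_mul (by omega) hcon.le
    omega
  refine ⟨(N - 1) * d - N * r, d - r, ⟨by omega, ?_, ?_⟩, ?_⟩
  · rw [Nat.cast_sub hlt.le, Nat.cast_sub hle, Nat.cast_mul, Nat.cast_mul, Nat.cast_sub (by omega),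
      ← h.x_mul]
    have : (N : ℚ) * r = x * d := h.x_mul.symm
    push_cast
    field_simp
    linear_combination this
  · rw [Nat.cast_sub hlt.le, Nat.cast_sub hle, Nat.cast_mul, Nat.cast_mul, Nat.cast_sub (by omega)]
    push_cast
    linear_combination h.form
  · have : 1 / ((N : ℚ) - 1 - x) ≤ 1 := by
      rw [div_le_one (by linarith)]
      exact hpos
    linarith

lemma exists_rigidParams_lambdaSeq {N : ℕ} (hN : 4 ≤ N) (k : ℕ) :
    (∃ d r, RigidParams N d r (lambdaSeq N k)) ∧ lambdaSeq N k ≤ 2 := by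
  induction k with
  | zero => exact ⟨⟨1, 0, by norm_num, by simp [lambdaSeq], by norm_num⟩, by simp [lambdaSeq]⟩
  | succ k ih =>
    obtain ⟨⟨d, r, h⟩, hx⟩ := ih
    obtain ⟨d', r', h', hx'⟩ := h.step hN hx
    exact ⟨⟨d', r', h'⟩, hx'⟩

lemma RigidParams.den_eq {N d r : ℕ} {x : ℚ} (h : RigidParams N d r x) : x.den = d := by
  have hd : (d : ℚ) ≠ 0 := by exact_mod_cast h.d_pos.ne'
  have hx : x = ((N * r : ℕ) : ℤ) / ((d : ℤ) : ℚ) := by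
    rw [eq_div_iff (by exact_mod_cast hd)]
    exact_mod_cast h.x_mul
  have h1 := Rat.den_div_eq_of_coprime (a := ((N * r : ℕ) : ℤ)) (b := (d : ℤ))
    (by exact_mod_cast h.d_pos) (by simpa [Int.natAbs_mul] using h.coprime.symm)
  rw [← hx] at h1
  exact_mod_cast h1

lemma exists_rigidParams_of_mem_Lambda {N : ℕ} {x : ℚ} (hx : x ∈ Lambda N) :
    ∃ r, RigidParams N x.den r x := by
  rcases hx with ⟨rfl, rfl⟩ | ⟨hN, k, rfl⟩
  · have h : RigidParams 3 2 1 (3 / 2) := ⟨by norm_num, by norm_num, by norm_num⟩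
    rw [h.den_eq]
    exact ⟨1, h⟩
  · obtain ⟨⟨d, r, h⟩, -⟩ := exists_rigidParams_lambdaSeq hN k
    rw [h.den_eq]
    exact ⟨r, h⟩

end LambdaSeq

/-! ### Pairs of projections with prescribed diagonal sum. -/

section Reflections

variable {d : ℕ}

/-- The off-diagonal part of a reflection with diagonal part `c / 2` that pairs `i` with `s i`. -/
def pairing (s : Fin d → Fin d) (c : Fin d → ℝ) : Matrix (Fin d) (Fin d) ℂ :=
  Matrix.of fun i j => if j = s i then ((Real.sqrt (4 - c i ^ 2) : ℝ) : ℂ) else 0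

/-- The projection `(1 + (diag c + ε D) / 2) / 2`, where `D` is the pairing matrix. -/
def pairProj (ε : ℝ) (s : Fin d → Fin d) (c : Fin d → ℝ) : Matrix (Fin d) (Fin d) ℂ :=
  (1 / 2 : ℂ) • (1 + (1 / 2 : ℂ) •
    (Matrix.diagonal (fun i => (c i : ℂ)) + (ε : ℂ) • pairing s c))

/-- With `C` the diagonal and `D` the pairing, `D² = 4 - C²`, and they anticommute because `s`
reverses the sign of `c`; so `(C + ε D)² = 4`. At a fixed point of `s` where `c` is not reversed,
`c² = 4` makes the entry of `D` vanish. -/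
lemma isStarProjection_pairProj {ε : ℝ} (hε : ε ^ 2 = 1) {s : Fin d → Fin d} {c : Fin d → ℝ}
    (hs : ∀ i, s (s i) = i) (hc : ∀ i, c i ^ 2 ≤ 4)
    (hsc : ∀ i, c (s i) = -c i ∨ (s i = i ∧ c i ^ 2 = 4)) :
    IsStarProjection (pairProj ε s c) := by
  have hsq : ∀ i, c (s i) ^ 2 = c i ^ 2 := fun i => by
    rcases hsc i with h | ⟨h, -⟩
    · rw [h, neg_sq]
    · rw [h]
  have hDh : (pairing s c)ᴴ = pairing s c := by
    ext i j
    rw [Matrix.conjTranspose_apply, pairing, Matrix.of_apply, Matrix.of_apply, Complex.star_def]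
    by_cases h : j = s i
    · subst h
      rw [if_pos (hs i).symm, if_pos rfl, Complex.conj_ofReal, hsq]
    · rw [if_neg h, if_neg, map_zero]
      rintro rfl
      exact h (hs j).symm
  have hsqrt : ∀ i, ((Real.sqrt (4 - c i ^ 2) : ℝ) : ℂ) * ((Real.sqrt (4 - c i ^ 2) : ℝ) : ℂ) =
      4 - (c i : ℂ) ^ 2 := fun i => by
    rw [← Complex.ofReal_mul, Real.mul_self_sqrt (by linarith [hc i])]
    push_cast
    rfl
  have hDD : pairing s c * pairing s c =
      Matrix.diagonal fun i => 4 - (c i : ℂ) ^ 2 := by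
    ext i j
    rw [Matrix.mul_apply, Finset.sum_eq_single (s i)]
    · simp only [pairing, Matrix.of_apply, if_true, hs, hsq, Matrix.diagonal_apply]
      by_cases h : i = j
      · subst h
        rw [if_pos rfl, if_pos rfl, hsqrt]
      · rw [if_neg h, if_neg (Ne.symm h), mul_zero]
    · intro k _ hk
      rw [pairing, Matrix.of_apply, if_neg hk, zero_mul]
    · simp
  have hanti : Matrix.diagonal (fun i => (c i : ℂ)) * pairing s c +
      pairing s c * Matrix.diagonal (fun i => (c i : ℂ)) = 0 := by
    ext i j
    rw [Matrix.add_apply, Matrix.diagonal_mul, Matrix.mul_diagonal, pairing, Matrix.of_apply,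
      Matrix.zero_apply]
    split_ifs with h
    · subst h
      rcases hsc i with h | ⟨h, h2⟩
      · rw [h]
        push_cast
        ring
      · rw [h2, sub_self, Real.sqrt_zero]
        simp
    · simp
  set D := pairing s c with hD
  set C := Matrix.diagonal (fun i => (c i : ℂ)) with hC
  have hCC : C * C = Matrix.diagonal fun i => (c i : ℂ) ^ 2 := by
    rw [hC, Matrix.diagonal_mul_diagonal]
    simp only [sq]
  have hA : (C + (ε : ℂ) • D) * (C + (ε : ℂ) • D) = (4 : ℂ) • 1 := by
    have hε' : (ε : ℂ) * ε = 1 := by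
      rw [← Complex.ofReal_mul, ← sq, hε, Complex.ofReal_one]
    have h1 : (C + (ε : ℂ) • D) * (C + (ε : ℂ) • D) =
        C * C + (ε : ℂ) • (C * D + D * C) + ((ε : ℂ) * ε) • (D * D) := by
      simp only [mul_add, add_mul, mul_smul_comm, smul_mul_assoc, smul_add, smul_smul]
      abel
    rw [h1, hanti, hCC, hDD, hε', smul_zero, add_zero, one_smul, Matrix.diagonal_add,
      ← Matrix.diagonal_one, ← Matrix.diagonal_smul]
    congr 1
    ext i
    simp
  refine ⟨?_, ?_⟩
  · rw [IsIdempotentElem, pairProj]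
    have h1 : ∀ A : Matrix (Fin d) (Fin d) ℂ, A * A = (4 : ℂ) • 1 →
        ((1 / 2 : ℂ) • (1 + (1 / 2 : ℂ) • A)) * ((1 / 2 : ℂ) • (1 + (1 / 2 : ℂ) • A)) =
        (1 / 2 : ℂ) • (1 + (1 / 2 : ℂ) • A) := by
      intro A hA
      simp only [mul_add, add_mul, mul_smul_comm, smul_mul_assoc, smul_smul, mul_one,
        one_mul, smul_add, hA]
      module
    exact h1 _ hA
  · rw [IsSelfAdjoint, Matrix.star_eq_conjTranspose, pairProj]
    simp only [Matrix.conjTranspose_smul, Matrix.conjTranspose_add, Matrix.conjTranspose_one, ← hD,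
      hDh, Matrix.diagonal_conjTranspose]
    congr 3
    · simp
    · simp
    · congr 1
      · congr 1
        ext i
        simp
      · simp

end Reflections

/-! ### Extracting elementary matrices from a Lie algebra. -/

section Generation

variable {d : ℕ} {L : Submodule ℂ (Matrix (Fin d) (Fin d) ℂ)}

/-- The bracket with `diagonal c` multiplies the `(i, j)` entry by `c i - c j`; iterates and linear
combinations give every polynomial in this weight. -/
lemma polynomial_ad_mem (hbr : ∀ X ∈ L, ∀ Y ∈ L, X * Y - Y * X ∈ L) {c : Fin d → ℂ}
    (hc : Matrix.diagonal c ∈ L) {X : Matrix (Fin d) (Fin d) ℂ} (hX : X ∈ L)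
    (p : Polynomial ℂ) : (Matrix.of fun i j => p.eval (c i - c j) * X i j) ∈ L := by
  induction p using Polynomial.induction_on with
  | C a =>
    convert L.smul_mem a hX using 1
    ext i j
    simp
  | add p q hp hq =>
    convert L.add_mem hp hq using 1
    ext i j
    simp [add_mul]
  | monomial n a ih =>
    convert hbr _ hc _ ih using 1
    ext i j
    rw [Matrix.sub_apply, Matrix.diagonal_mul, Matrix.mul_diagonal]
    simp only [Matrix.of_apply, Polynomial.eval_mul, Polynomial.eval_C, Polynomial.eval_pow,
      Polynomial.eval_X]
    ring

/-- An entry of `X ∈ L` that is isolated among the weights of `diagonal c ∈ L` can be extracted. -/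
lemma single_mem_of_diagonal_mem (hbr : ∀ X ∈ L, ∀ Y ∈ L, X * Y - Y * X ∈ L) {c : Fin d → ℂ}
    (hc : Matrix.diagonal c ∈ L) {X : Matrix (Fin d) (Fin d) ℂ} (hX : X ∈ L) {a b : Fin d}
    (hab : X a b ≠ 0)
    (hiso : ∀ i j, X i j ≠ 0 → c i - c j = c a - c b → i = a ∧ j = b) :
    Matrix.single a b (1 : ℂ) ∈ L := by
  classical
  set S := (Finset.univ.image fun p : Fin d × Fin d => c p.1 - c p.2).erase (c a - c b) with hS
  -- A polynomial vanishing at every weight except that of `(a, b)`.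
  set p : Polynomial ℂ := ∏ δ ∈ S, (Polynomial.X - Polynomial.C δ) with hp
  have hpab : p.eval (c a - c b) ≠ 0 := by
    rw [hp, Polynomial.eval_prod, Finset.prod_ne_zero_iff]
    intro δ hδ
    rw [Polynomial.eval_sub, Polynomial.eval_X, Polynomial.eval_C, sub_ne_zero]
    exact (Finset.ne_of_mem_erase hδ).symm
  have h0 : ∀ i j, c i - c j ≠ c a - c b → p.eval (c i - c j) = 0 := by
    intro i j hij
    rw [hp, Polynomial.eval_prod]
    refine Finset.prod_eq_zero (i := c i - c j) ?_ (by simp)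
    exact Finset.mem_erase.mpr ⟨hij, Finset.mem_image.mpr ⟨(i, j), Finset.mem_univ _, rfl⟩⟩
  have h1 := polynomial_ad_mem hbr hc hX p
  have h2 : (Matrix.of fun i j => p.eval (c i - c j) * X i j) =
      (p.eval (c a - c b) * X a b) • Matrix.single a b (1 : ℂ) := by
    ext i j
    rw [Matrix.of_apply, Matrix.smul_apply, Matrix.single_apply]
    by_cases hij : a = i ∧ b = j
    · obtain ⟨rfl, rfl⟩ := hij
      simp
    · rw [if_neg hij, smul_zero]
      by_cases hx : X i j = 0
      · rw [hx, mul_zero]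
      · rw [h0, zero_mul]
        intro h
        obtain ⟨rfl, rfl⟩ := hiso i j hx h
        exact hij ⟨rfl, rfl⟩
  rw [h2] at h1
  exact (L.smul_mem_iff (mul_ne_zero hpab hab)).mp h1

/-- `i` and `j` are linked if the elementary matrices at `(i, j)` and `(j, i)` are in `L`. -/
def Linked (L : Submodule ℂ (Matrix (Fin d) (Fin d) ℂ)) (i j : Fin d) : Prop :=
  i = j ∨ (i ≠ j ∧ Matrix.single i j (1 : ℂ) ∈ L ∧ Matrix.single j i (1 : ℂ) ∈ L)

lemma Linked.symm {i j : Fin d} (h : Linked L i j) : Linked L j i := by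
  rcases h with h | ⟨h1, h2, h3⟩
  · exact Or.inl h.symm
  · exact Or.inr ⟨h1.symm, h3, h2⟩

lemma Linked.trans (hbr : ∀ X ∈ L, ∀ Y ∈ L, X * Y - Y * X ∈ L) {i j k : Fin d}
    (h : Linked L i j) (h' : Linked L j k) : Linked L i k := by
  rcases h with rfl | ⟨h1, h2, h3⟩
  · exact h'
  rcases h' with rfl | ⟨h1', h2', h3'⟩
  · exact Or.inr ⟨h1, h2, h3⟩
  by_cases hik : i = k
  · exact Or.inl hik
  refine Or.inr ⟨hik, ?_, ?_⟩
  · have := hbr _ h2 _ h2'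
    rwa [Matrix.single_mul_single_same, Matrix.single_mul_single_of_ne _ _ _ _ (Ne.symm hik),
      sub_zero, mul_one] at this
  · have := hbr _ h3' _ h3
    rwa [Matrix.single_mul_single_same, Matrix.single_mul_single_of_ne _ _ _ _ hik,
      sub_zero, mul_one] at this

lemma eq_top_of_linked (h1 : 1 ∈ L) (hbr : ∀ X ∈ L, ∀ Y ∈ L, X * Y - Y * X ∈ L)
    (h : ∀ i j, Linked L i j) : L = ⊤ := by
  have hdiff : ∀ i j : Fin d, Matrix.single i i (1 : ℂ) - Matrix.single j j 1 ∈ L := by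
    intro i j
    rcases h i j with rfl | ⟨-, h2, h3⟩
    · rw [sub_self]
      exact L.zero_mem
    · have := hbr _ h2 _ h3
      rwa [Matrix.single_mul_single_same, Matrix.single_mul_single_same, mul_one] at this
  have hdiag : ∀ i : Fin d, Matrix.single i i (1 : ℂ) ∈ L := by
    intro i
    have hd : (d : ℂ) ≠ 0 := by exact_mod_cast (Fin.pos i).ne'
    -- Brackets give only traceless diagonal matrices; the identity supplies the missing trace.
    have h2 : (d : ℂ) • Matrix.single i i (1 : ℂ) =
        1 + ∑ j, (Matrix.single i i (1 : ℂ) - Matrix.single j j 1) := by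
      rw [Finset.sum_sub_distrib, Matrix.sum_single_one]
      simp [Nat.cast_smul_eq_nsmul]
    refine (L.smul_mem_iff hd).mp ?_
    rw [h2]
    exact L.add_mem h1 (L.sum_mem fun j _ => hdiff i j)
  rw [Submodule.eq_top_iff']
  intro X
  rw [Matrix.matrix_eq_sum_single X]
  refine L.sum_mem fun i _ => L.sum_mem fun j _ => ?_
  have h2 : Matrix.single i j (1 : ℂ) ∈ L := by
    rcases h i j with rfl | ⟨-, h2, -⟩
    · exact hdiag i
    · exact h2
  have := L.smul_mem (X i j) h2
  rwa [Matrix.smul_single, smul_eq_mul, mul_one] at this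

end Generation

/-! ### Generation of `gl_d` by four projections, for odd `d`. -/

section FourProjections

variable {d : ℕ}

/-- The reflection `i ↦ -i` of `ℤ/d`. -/
def reflA (i : Fin d) : Fin d :=
  if h : (i : ℕ) = 0 then i else ⟨d - i, by omega⟩

/-- The reflection `i ↦ -2 - i` of `ℤ/d`. -/
def reflB (i : Fin d) : Fin d :=
  if h : (i : ℕ) + 1 = d then i else ⟨d - 2 - i, by omega⟩

/-- The spectrum of the sum of the first two reflections. -/
def specA (d : ℕ) (i : Fin d) : ℝ := 4 * (i : ℕ) / d - 2

/-- The spectrum of the sum of the last two reflections. -/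
def specB (d : ℕ) (i : Fin d) : ℝ := 2 - 4 * ((i : ℕ) + 1) / d

/-- Four projections of `ℂ^d` with sum `2 (d - 1) / d`. -/
def fourProj (d : ℕ) : Fin 4 → Matrix (Fin d) (Fin d) ℂ :=
  ![pairProj 1 reflA (specA d), pairProj (-1) reflA (specA d),
    pairProj 1 reflB (specB d), pairProj (-1) reflB (specB d)]

lemma specA_sq_lt {i : Fin d} (hi : (i : ℕ) ≠ 0) : specA d i ^ 2 < 4 := by
  have hd : (0 : ℝ) < d := by exact_mod_cast Fin.pos i
  have h0 : (0 : ℝ) < ((i : ℕ) : ℝ) / d := div_pos (by exact_mod_cast Nat.pos_of_ne_zero hi) hd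
  have h1 : ((i : ℕ) : ℝ) / d < 1 := by
    rw [div_lt_one hd]
    exact_mod_cast i.2
  rw [specA, mul_div_assoc]
  nlinarith

lemma specB_sq_lt {i : Fin d} (hi : (i : ℕ) + 1 ≠ d) : specB d i ^ 2 < 4 := by
  have hd : (0 : ℝ) < d := by exact_mod_cast Fin.pos i
  have h0 : (0 : ℝ) < (((i : ℕ) : ℝ) + 1) / d := div_pos (by positivity) hd
  have h1 : (((i : ℕ) : ℝ) + 1) / d < 1 := by
    rw [div_lt_one hd]
    have : (i : ℕ) + 1 < d := by omega
    exact_mod_cast this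
  rw [specB, mul_div_assoc]
  nlinarith

lemma specA_zero {i : Fin d} (hi : (i : ℕ) = 0) : specA d i ^ 2 = 4 := by
  rw [specA, hi]
  norm_num

lemma specB_last {i : Fin d} (hi : (i : ℕ) + 1 = d) : specB d i ^ 2 = 4 := by
  have hd : (d : ℝ) ≠ 0 := by exact_mod_cast (Fin.pos i).ne'
  have : ((i : ℕ) : ℝ) + 1 = d := by exact_mod_cast hi
  rw [specB, this, mul_div_assoc, div_self hd]
  norm_num

lemma reflA_val {i : Fin d} (hi : (i : ℕ) ≠ 0) : (reflA i : ℕ) = d - i := by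
  rw [reflA, dif_neg hi]

lemma reflB_val {i : Fin d} (hi : (i : ℕ) + 1 ≠ d) : (reflB i : ℕ) = d - 2 - i := by
  rw [reflB, dif_neg hi]

/-- Within each pair the off-diagonal parts cancel, and `specA + specB` is the constant `-4 / d`.
Each reflection of the indices negates its spectrum away from its fixed endpoint, where the value is
`-2`. -/
lemma isProjFamily_fourProj (hd : 1 ≤ d) :
    IsProjFamily (2 * ((d : ℚ) - 1) / d) (fourProj d) where
  isProj := by
    have hdR : (d : ℝ) ≠ 0 := by exact_mod_cast (by omega : d ≠ 0)
    have hA : ∀ ε : ℝ, ε ^ 2 = 1 → IsStarProjection (pairProj ε reflA (specA d)) := by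
      intro ε hε
      refine isStarProjection_pairProj hε (fun i => ?_) (fun i => ?_) fun i => ?_
      · by_cases hi : (i : ℕ) = 0
        · simp [reflA, hi]
        · have h1 := reflA_val hi
          refine Fin.ext ?_
          rw [reflA_val (by omega), h1]
          omega
      · by_cases hi : (i : ℕ) = 0
        · exact (specA_zero hi).le
        · exact (specA_sq_lt hi).le
      · by_cases hi : (i : ℕ) = 0
        · exact Or.inr ⟨by rw [reflA, dif_pos hi], specA_zero hi⟩
        · refine Or.inl ?_
          rw [specA, specA, reflA_val hi, Nat.cast_sub i.2.le]
          field_simp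
          ring
    have hB : ∀ ε : ℝ, ε ^ 2 = 1 → IsStarProjection (pairProj ε reflB (specB d)) := by
      intro ε hε
      refine isStarProjection_pairProj hε (fun i => ?_) (fun i => ?_) fun i => ?_
      · by_cases hi : (i : ℕ) + 1 = d
        · simp [reflB, hi]
        · have h1 := reflB_val hi
          refine Fin.ext ?_
          rw [reflB_val (by omega), h1]
          omega
      · by_cases hi : (i : ℕ) + 1 = d
        · exact (specB_last hi).le
        · exact (specB_sq_lt hi).le
      · by_cases hi : (i : ℕ) + 1 = d
        · exact Or.inr ⟨by rw [reflB, dif_pos hi], specB_last hi⟩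
        · refine Or.inl ?_
          rw [specB, specB, reflB_val hi, Nat.cast_sub (by omega), Nat.cast_sub (by omega)]
          field_simp
          push_cast
          ring
    intro μ
    fin_cases μ
    · exact hA 1 (by norm_num)
    · exact hA (-1) (by norm_num)
    · exact hB 1 (by norm_num)
    · exact hB (-1) (by norm_num)
  sum_eq := by
    have hdC : (d : ℂ) ≠ 0 := by exact_mod_cast (by omega : d ≠ 0)
    rw [Fin.sum_univ_four]
    ext i j
    simp only [fourProj, pairProj, Matrix.add_apply, Matrix.smul_apply, Matrix.cons_val,
      smul_eq_mul, Matrix.diagonal_apply, Matrix.one_apply, specA, specB]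
    by_cases h : i = j
    · simp only [h, if_true]
      push_cast
      field_simp
      ring
    · simp only [h, if_false]
      push_cast
      ring

/-- Sums and differences of each pair put the diagonal and both pairings in `L`. The weights of
`specA` separate the nonzero entries of either pairing, so `i` is linked to `d - i` and to `d - 2 -
i`. Composing the two shifts by two, and for odd `d` these links connect all indices. -/
lemma lieGenerates_fourProj (hd : Odd d) : LieGenerates (fourProj d) := by
  intro L h1 hPL hbr
  have hdR : (d : ℝ) ≠ 0 := by exact_mod_cast hd.pos.ne'
  have hcA : Matrix.diagonal (fun i => (specA d i : ℂ)) ∈ L := by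
    have h := L.smul_mem 2 (L.sub_mem (L.add_mem (hPL 0) (hPL 1)) h1)
    convert h using 1
    simp only [fourProj, pairProj, Matrix.cons_val]
    push_cast
    module
  have hD : ∀ s c, pairProj 1 s c ∈ L → pairProj (-1) s c ∈ L → pairing s c ∈ L := by
    intro s c hp hm
    have h := L.smul_mem 2 (L.sub_mem hp hm)
    convert h using 1
    simp only [pairProj]
    push_cast
    module
  have hDA := hD _ _ (hPL 0) (hPL 1)
  have hDB := hD _ _ (hPL 2) (hPL 3)
  have hsqrt : ∀ c : ℝ, c ^ 2 < 4 → ((Real.sqrt (4 - c ^ 2) : ℝ) : ℂ) ≠ 0 := fun c hc => by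
    rw [Complex.ofReal_ne_zero, Real.sqrt_ne_zero']
    linarith
  have hEA : ∀ i : Fin d, (i : ℕ) ≠ 0 → Matrix.single i (reflA i) (1 : ℂ) ∈ L := by
    intro i hi
    refine single_mem_of_diagonal_mem hbr hcA hDA ?_ ?_
    · rw [pairing, Matrix.of_apply, if_pos rfl]
      exact hsqrt _ (specA_sq_lt hi)
    · intro k j hkj heq
      have hj : j = reflA k := by
        by_contra hne
        exact hkj (by rw [pairing, Matrix.of_apply, if_neg hne])
      subst hj
      have hk : (k : ℕ) ≠ 0 := by
        intro h0
        refine hkj ?_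
        rw [pairing, Matrix.of_apply, if_pos rfl, specA_zero h0, sub_self, Real.sqrt_zero,
          Complex.ofReal_zero]
      have heq' : specA d k - specA d (reflA k) = specA d i - specA d (reflA i) := by
        exact_mod_cast heq
      simp only [specA, reflA_val hk, reflA_val hi, Nat.cast_sub k.2.le,
        Nat.cast_sub i.2.le] at heq'
      field_simp at heq'
      have h3 : ((k : ℕ) : ℝ) = (i : ℕ) := by linarith
      have h4 : k = i := Fin.ext (by exact_mod_cast h3)
      exact ⟨h4, by rw [h4]⟩
  have hEB : ∀ i : Fin d, (i : ℕ) + 1 ≠ d → Matrix.single i (reflB i) (1 : ℂ) ∈ L := by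
    intro i hi
    refine single_mem_of_diagonal_mem hbr hcA hDB ?_ ?_
    · rw [pairing, Matrix.of_apply, if_pos rfl]
      exact hsqrt _ (specB_sq_lt hi)
    · intro k j hkj heq
      have hj : j = reflB k := by
        by_contra hne
        exact hkj (by rw [pairing, Matrix.of_apply, if_neg hne])
      subst hj
      have hk : (k : ℕ) + 1 ≠ d := by
        intro h0
        refine hkj ?_
        rw [pairing, Matrix.of_apply, if_pos rfl, specB_last h0, sub_self, Real.sqrt_zero,
          Complex.ofReal_zero]
      have heq' : specA d k - specA d (reflB k) = specA d i - specA d (reflB i) := by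
        exact_mod_cast heq
      have ek : ((d - 2 - (k : ℕ) : ℕ) : ℝ) = d - 2 - (k : ℕ) := by
        rw [Nat.cast_sub (by omega), Nat.cast_sub (by omega)]
        norm_num
      have ei : ((d - 2 - (i : ℕ) : ℕ) : ℝ) = d - 2 - (i : ℕ) := by
        rw [Nat.cast_sub (by omega), Nat.cast_sub (by omega)]
        norm_num
      simp only [specA, reflB_val hk, reflB_val hi, ek, ei] at heq'
      field_simp at heq'
      have h3 : ((k : ℕ) : ℝ) = (i : ℕ) := by linarith
      have h4 : k = i := Fin.ext (by exact_mod_cast h3)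
      exact ⟨h4, by rw [h4]⟩
  have hlinkA : ∀ i j : Fin d, (i : ℕ) + j = d → Linked L i j := by
    intro i j hij
    have hi : (i : ℕ) ≠ 0 := by omega
    have hj : (j : ℕ) ≠ 0 := by omega
    have e1 : reflA i = j := Fin.ext (by rw [reflA_val hi]; omega)
    have e2 : reflA j = i := Fin.ext (by rw [reflA_val hj]; omega)
    refine Or.inr ⟨?_, e1 ▸ hEA i hi, e2 ▸ hEA j hj⟩
    -- A self-link would mean `2 i = d`, impossible for odd `d`.
    rintro rfl
    obtain ⟨t, ht⟩ := hd
    omega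
  have hlinkB : ∀ i j : Fin d, (i : ℕ) + j + 2 = d → Linked L i j := by
    intro i j hij
    have hi : (i : ℕ) + 1 ≠ d := by omega
    have hj : (j : ℕ) + 1 ≠ d := by omega
    have e1 : reflB i = j := Fin.ext (by rw [reflB_val hi]; omega)
    have e2 : reflB j = i := Fin.ext (by rw [reflB_val hj]; omega)
    refine Or.inr ⟨?_, e1 ▸ hEB i hi, e2 ▸ hEB j hj⟩
    rintro rfl
    obtain ⟨t, ht⟩ := hd
    omega
  have heven : ∀ (t : ℕ) (h : 2 * t < d), Linked L ⟨0, hd.pos⟩ ⟨2 * t, h⟩ := by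
    intro t
    induction t with
    | zero => exact fun _ => Or.inl rfl
    | succ t ih =>
      intro h
      -- The path is `2 t`, then `d - 2 - 2 t`, then `2 t + 2`.
      refine (ih (by omega)).trans hbr ((hlinkB _ ⟨d - 2 - 2 * t, by omega⟩ ?_).trans hbr
        (hlinkA _ _ ?_))
      · simp only
        omega
      · simp only
        omega
  have hzero : ∀ i : Fin d, Linked L ⟨0, hd.pos⟩ i := by
    intro i
    obtain ⟨t, ht⟩ := hd
    rcases Nat.even_or_odd' (i : ℕ) with ⟨u, hu | hu⟩
    · have := heven u (by omega)
      rwa [show (⟨2 * u, by omega⟩ : Fin d) = i from Fin.ext hu.symm] at this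
    · refine (heven (t - u) (by omega)).trans hbr (hlinkA _ _ ?_)
      simp only
      omega
  exact eq_top_of_linked h1 hbr fun i j => (hzero i).symm.trans hbr (hzero j)

lemma rigidParams_four (hd : Odd d) :
    RigidParams 4 d ((d - 1) / 2) (2 * ((d : ℚ) - 1) / d) := by
  obtain ⟨e, rfl⟩ := hd
  have he : (2 * e + 1 - 1) / 2 = e := by omega
  rw [he]
  refine ⟨by omega, ?_, ?_⟩
  · have : ((2 * e + 1 : ℕ) : ℚ) ≠ 0 := by exact_mod_cast (by omega : 2 * e + 1 ≠ 0)
    rw [div_mul_cancel₀ _ this]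
    push_cast
    ring
  · push_cast
    ring

end FourProjections

end SlaterSelfTest

end

theorem mainTheorem2 :
    (∀ (N d : ℕ) (x : ℚ), x ∈ SlaterSelfTest.Lambda N → x.den = d →
      ∀ (P : Fin N → Matrix (Fin d) (Fin d) ℂ) (hP : SlaterSelfTest.IsProjFamily x P),
        SlaterSelfTest.SlaterUnique P → (SlaterSelfTest.canonical hP).SelfTests) ∧
    (∀ d : ℕ, 1 ≤ d →
      (∃ P : Fin (d + 1) → Matrix (Fin d) (Fin d) ℂ,
        SlaterSelfTest.IsProjFamily (((d : ℚ) + 1) / d) P) ∧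
      ∀ (P : Fin (d + 1) → Matrix (Fin d) (Fin d) ℂ)
        (hP : SlaterSelfTest.IsProjFamily (((d : ℚ) + 1) / d) P),
        (SlaterSelfTest.canonical hP).SelfTests) ∧
    (∀ d : ℕ, Odd d →
      (∃ P : Fin 4 → Matrix (Fin d) (Fin d) ℂ,
        SlaterSelfTest.IsProjFamily (2 * ((d : ℚ) - 1) / d) P) ∧
      ∀ (P : Fin 4 → Matrix (Fin d) (Fin d) ℂ)
        (hP : SlaterSelfTest.IsProjFamily (2 * ((d : ℚ) - 1) / d) P),
        (SlaterSelfTest.canonical hP).SelfTests) := by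
  refine ⟨?_, fun d hd => ⟨⟨_, SlaterSelfTest.isProjFamily_simplexProj hd⟩, fun P hP => ?_⟩,
    fun d hd => ⟨⟨_, SlaterSelfTest.isProjFamily_fourProj hd.pos⟩, fun P hP => ?_⟩⟩
  · rintro N d x hx rfl P hP hu
    obtain ⟨r, hr⟩ := SlaterSelfTest.exists_rigidParams_of_mem_Lambda hx
    exact hr.selfTests hP hu
  · have h := SlaterSelfTest.rigidParams_simplex hd
    exact h.selfTests hP (SlaterSelfTest.slaterUnique_of_lieGenerates hP.idem
      (h.lieGenerates hP (SlaterSelfTest.isProjFamily_simplexProj hd)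
        (SlaterSelfTest.lieGenerates_simplexProj hd)))
  · have h := SlaterSelfTest.rigidParams_four hd
    exact h.selfTests hP (SlaterSelfTest.slaterUnique_of_lieGenerates hP.idem
      (h.lieGenerates hP (SlaterSelfTest.isProjFamily_fourProj hd.pos)
        (SlaterSelfTest.lieGenerates_fourProj hd)))
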